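/- Let $d\ge 1$, $p\ge 0$, $\Theta=[\theta_{\inf},\theta_{\sup}]^p$ and $\theta_0\in\Theta$ with $\theta_{\inf}<(\theta_0)_i<\theta_{\sup}$ for $1\le i\le p$. Let $\{K_\theta,\theta\in\Theta\}$ be functions $K_\theta:\mathbb{R}^d\to\mathbb{R}$ such that: (a) each $K_\theta$ is a stationary covariance function, that is, every matrix $(K_\theta(t_i-t_j))_{i,j}$ with $t_1,\dots,t_m\in\mathbb{R}^d$ is symmetric positive semidefinite; (b) $K_\theta(t)$ has all its partial derivatives in $\theta$ up to order three on $\Theta$ (one-sided at the boundary), and for all $q\in\{0,\dots,3\}$ and $i_1,\dots,i_q\in\{1,\dots,p\}$ there is $C_{i_1,\dots,i_q}<\infty$ such that $\left|\frac{\partial}{\partial\theta_{i_1}}\cdots\frac{\partial}{\partial\theta_{i_q}}K_\theta(t)\right|\le \frac{C_{i_1,\dots,i_q}}{1+|t|^{d+1}}$ for all $\theta\in\Theta$, $t\in\mathbb{R}^d$, with $|\cdot|$ the Euclidean norm; (c) with $\hat K_\theta(f)=\frac{1}{(2\pi)^d}\int_{\mathbb{R}^d}K_\theta(t)e^{-\mathrm{i}f\cdot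 t}\,dt$, the function $\hat K_\theta$ is integrable and $K_\theta(t)=\int_{\mathbb{R}^d}\hat K_\theta(f)e^{\mathrm{i}f\cdot t}\,df$ for all $\theta\in\Theta$ and $t\in\mathbb{R}^d$, and $(f,\theta)\mapsto\hat K_\theta(f)$ is continuous and positive on $\mathbb{R}^d\times\Theta$; (d) $K_\theta(0)=1$ for all $\theta\in\Theta$. Let $(v_i)_{i\ge1}$ be a sequence of points with positive integer coordinates such that $\{v_i:1\le i\le N^d\}=\{1,\dots,N\}^d$ for all $N\ge1$, let $\epsilon\in[0,\frac12)$, and let $(X_i)_{i\ge1}$ be i.i.d. with a law $\mathcal{L}_X$ that is symmetric, has (topological) support $S_X\subset[-1,1]^d$, and has a probability density that is positive on $S_X$. For $n\ge 1$ let $R$ and $\frac{\partial R}{\partial\theta_k}$ be the $n\times n$ matrices with entries $K_{\theta_0}(v_i-v_j+\epsilon(X_i-X_j))$ and $\frac{\partial}{\partial\theta_k}K_{\theta_0}(v_i-v_j+\epsilon(X_i-X_j))$, let $\operatorname{diag}(A)$ be the matrix $A$ with its off-diagonal entries set to $0$, and let $$\begin{aligned}M_{CV,2}^{i,j}={}&-8\operatorname{diag}(R^{-1})^{-3}\operatorname{diag}\!\left(R^{-1}\tfrac{\partial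 R}{\partial\theta_i}R^{-1}\right)R^{-1}\tfrac{\partial R}{\partial\theta_j}R^{-1}+2\operatorname{diag}(R^{-1})^{-2}R^{-1}\tfrac{\partial R}{\partial\theta_i}R^{-1}\tfrac{\partial R}{\partial\theta_j}R^{-1}\\&+6\operatorname{diag}(R^{-1})^{-4}\operatorname{diag}\!\left(R^{-1}\tfrac{\partial R}{\partial\theta_i}R^{-1}\right)\operatorname{diag}\!\left(R^{-1}\tfrac{\partial R}{\partial\theta_j}R^{-1}\right)R^{-1}.\end{aligned}$$ Then there is a (necessarily unique) deterministic $p\times p$ matrix $\Sigma_{CV,2}$ such that, for all $1\le i,j\le p$, $\frac1n\operatorname{Tr}(M_{CV,2}^{i,j})\to(\Sigma_{CV,2})_{i,j}$ almost surely as $n\to\infty$, and: 1. For $\epsilon=0$: if there is no $(\lambda_1,\dots,\lambda_p)\in\mathbb{R}^p$, different from zero, such that $\sum_{k=1}^p\lambda_k\frac{\partial}{\partial\theta_k}K_{\theta_0}(v)=0$ for all $v\in\mathbb{Z}^d$, then $\Sigma_{CV,2}$ is (symmetric) positive definite. 2. For $\epsilon\ne0$, let $D_\epsilon=\bigcup_{v\in\mathbb{Z}^d\setminus\{0\}}(v+\epsilon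 C_{S_X})$ with $C_{S_X}=\{t_1-t_2:t_1,t_2\in S_X\}$. If there is no $(\lambda_1,\dots,\lambda_p)\in\mathbb{R}^p$, different from zero, such that $\sum_{k=1}^p\lambda_k\frac{\partial}{\partial\theta_k}K_{\theta_0}(t)=0$ for Lebesgue-almost every $t\in D_\epsilon$, then $\Sigma_{CV,2}$ is (symmetric) positive definite. -/

import Mathlib

open MeasureTheory ProbabilityTheory Filter Topology
open scoped Matrix

noncomputable section

namespace CrossValidation

/-- `ℝ^d` with its Euclidean norm and Lebesgue measure. -/
abbrev E (d : ℕ) := EuclideanSpace ℝ (Fin d)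

/-- The parameter set `Θ = [θinf, θsup]^p`. -/
def paramBox (p : ℕ) (θinf θsup : ℝ) : Set (Fin p → ℝ) :=
  {θ | ∀ i, θ i ∈ Set.Icc θinf θsup}

/-- The partial derivative `∂g/∂θ_i` of a function on the box `[θinf, θsup]^p`
(one-sided on the faces of the box, the usual one where `θinf < θ_i < θsup`). -/
def partialDeriv {p : ℕ} (θinf θsup : ℝ) (i : Fin p) (g : (Fin p → ℝ) → ℝ) :
    (Fin p → ℝ) → ℝ :=
  fun θ => derivWithin (fun s => g (Function.update θ i s)) (Set.Icc θinf θsup) (θ i)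

/-- Existence of the partial derivative `∂g/∂θ_i` at `θ` (relative to the box). -/
def HasPartialAt {p : ℕ} (θinf θsup : ℝ) (i : Fin p) (g : (Fin p → ℝ) → ℝ)
    (θ : Fin p → ℝ) : Prop :=
  DifferentiableWithinAt ℝ (fun s => g (Function.update θ i s)) (Set.Icc θinf θsup) (θ i)

/-- The iterated partial derivative `∂/∂θ_{i_1} ⋯ ∂/∂θ_{i_q} g`, for the list `[i_1, …, i_q]`. -/
def iterPartial {p : ℕ} (θinf θsup : ℝ) (l : List (Fin p)) (g : (Fin p → ℝ) → ℝ) :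
    (Fin p → ℝ) → ℝ :=
  l.foldr (fun i h => partialDeriv θinf θsup i h) g

/-- `k` is the covariance function of a stationary process on `ℝ^d`: all the matrices
`(k (t_i - t_j))_{i,j}` are symmetric positive semidefinite. -/
def IsStationaryCovariance {d : ℕ} (k : E d → ℝ) : Prop :=
  ∀ (n : ℕ) (t : Fin n → E d), (Matrix.of fun i j => k (t i - t j)).PosSemidef

/-- The Fourier transform `ĥ(f) = (2π)^{-d} ∫ h(t) e^{-i f·t} dt`. -/
def fourierHat {d : ℕ} (h : E d → ℝ) (f : E d) : ℂ :=
  ((1 / (2 * Real.pi) ^ d : ℝ) : ℂ) *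
    ∫ t : E d, (h t : ℂ) * Complex.exp (-(Complex.I * ((inner ℝ f t : ℝ) : ℂ)))

/-- The standing condition on the parametric model `{K_θ, θ ∈ Θ}`. -/
structure ModelCondition (d p : ℕ) (θinf θsup : ℝ) (K : (Fin p → ℝ) → E d → ℝ) : Prop where
  stationary : ∀ θ ∈ paramBox p θinf θsup, IsStationaryCovariance (K θ)
  /-- `K_θ(t)` has all its partial derivatives in `θ` up to order three. -/
  differentiable : ∀ l : List (Fin p), l.length ≤ 2 → ∀ i : Fin p,
    ∀ θ ∈ paramBox p θinf θsup, ∀ t : E d,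
      HasPartialAt θinf θsup i (iterPartial θinf θsup l (fun η => K η t)) θ
  decay : ∀ l : List (Fin p), l.length ≤ 3 → ∃ C : ℝ,
    ∀ θ ∈ paramBox p θinf θsup, ∀ t : E d,
      |iterPartial θinf θsup l (fun η => K η t) θ| ≤ C / (1 + ‖t‖ ^ (d + 1))
  integrable_hat : ∀ θ ∈ paramBox p θinf θsup, Integrable (fourierHat (K θ))
  inversion : ∀ θ ∈ paramBox p θinf θsup, ∀ t : E d,
    (K θ t : ℂ) =
      ∫ f : E d, fourierHat (K θ) f * Complex.exp (Complex.I * ((inner ℝ f t : ℝ) : ℂ))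
  continuous_hat : ContinuousOn (fun q : E d × (Fin p → ℝ) => fourierHat (K q.2) q.1)
    (Set.univ ×ˢ paramBox p θinf θsup)
  positive_hat : ∀ θ ∈ paramBox p θinf θsup, ∀ f : E d,
    (fourierHat (K θ) f).im = 0 ∧ 0 < (fourierHat (K θ) f).re

/-- `v 0, v 1, …` enumerates the positive integer grid so that, for every `N ≥ 1`, the first
`N ^ d` points are those of `{1, …, N}^d`. -/
def IsGridEnumeration {d : ℕ} (v : ℕ → Fin d → ℕ) : Prop :=
  ∀ N : ℕ, 1 ≤ N → v '' Set.Iio (N ^ d) = {u | ∀ k, 1 ≤ u k ∧ u k ≤ N}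

/-- The condition on the law of the perturbations: a symmetric probability distribution whose
(topological) support lies in `[-1,1]^d`, with a density that is positive on this support. -/
structure PerturbationLaw {d : ℕ} (L : Measure (E d)) : Prop where
  isProbability : IsProbabilityMeasure L
  symmetric : L.map (fun x => -x) = L
  support_subset : L.support ⊆ {x | ∀ k, |x k| ≤ 1}
  density : ∃ f : E d → ENNReal, Measurable f ∧ L = volume.withDensity f ∧
    ∀ x ∈ L.support, 0 < f x

/-- An integer vector as a point of `ℝ^d`. -/
def latticePoint {d : ℕ} (v : Fin d → ℤ) : E d := WithLp.toLp 2 fun k => (v k : ℝ)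

/-- The observation point `v_i + ε x_i`. -/
def obsPoint {d : ℕ} (v : ℕ → Fin d → ℕ) (ε : ℝ) (x : ℕ → E d) (i : ℕ) : E d :=
  latticePoint (fun k => (v i k : ℤ)) + ε • x i

/-- The `n × n` matrix `R_θ = (K_θ(v_i - v_j + ε (x_i - x_j)))_{i,j}`. -/
def covMatrix {d p : ℕ} (K : (Fin p → ℝ) → E d → ℝ) (v : ℕ → Fin d → ℕ) (ε : ℝ)
    (x : ℕ → E d) (n : ℕ) (θ : Fin p → ℝ) : Matrix (Fin n) (Fin n) ℝ :=
  Matrix.of fun i j => K θ (obsPoint v ε x i - obsPoint v ε x j)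

/-- The `n × n` matrix `∂R_θ/∂θ_k`, the derivative being taken entrywise. -/
def dCovMatrix {d p : ℕ} (θinf θsup : ℝ) (K : (Fin p → ℝ) → E d → ℝ) (v : ℕ → Fin d → ℕ)
    (ε : ℝ) (x : ℕ → E d) (n : ℕ) (θ : Fin p → ℝ) (k : Fin p) : Matrix (Fin n) (Fin n) ℝ :=
  Matrix.of fun i j => partialDeriv θinf θsup k (fun η => covMatrix K v ε x n η i j) θ

/-- `diag(A)`: the matrix `A` with its off-diagonal entries set to zero. -/
def diagPart {n : ℕ} (A : Matrix (Fin n) (Fin n) ℝ) : Matrix (Fin n) (Fin n) ℝ :=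
  Matrix.diagonal A.diag

/-- The matrix `M_{CV,2}^{i,j}` built from `R` and from its derivatives `Ri`, `Rj`. -/
def cvHessianOf {n : ℕ} (R Ri Rj : Matrix (Fin n) (Fin n) ℝ) : Matrix (Fin n) (Fin n) ℝ :=
  (-8 : ℝ) • ((diagPart R⁻¹)⁻¹ ^ 3 * diagPart (R⁻¹ * Ri * R⁻¹) * (R⁻¹ * Rj * R⁻¹))
  + (2 : ℝ) • ((diagPart R⁻¹)⁻¹ ^ 2 * (R⁻¹ * Ri * R⁻¹ * Rj * R⁻¹))
  + (6 : ℝ) • ((diagPart R⁻¹)⁻¹ ^ 4 * diagPart (R⁻¹ * Ri * R⁻¹) * diagPart (R⁻¹ * Rj * R⁻¹)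
      * R⁻¹)

/-- `M_{CV,2}^{i,j}` at `θ0` for the first `n` observation points. -/
def cvHessian {d p : ℕ} (θinf θsup : ℝ) (K : (Fin p → ℝ) → E d → ℝ) (v : ℕ → Fin d → ℕ)
    (ε : ℝ) (x : ℕ → E d) (n : ℕ) (θ0 : Fin p → ℝ) (i j : Fin p) :
    Matrix (Fin n) (Fin n) ℝ :=
  cvHessianOf (covMatrix K v ε x n θ0) (dCovMatrix θinf θsup K v ε x n θ0 i)
    (dCovMatrix θinf θsup K v ε x n θ0 j)

/-- `S` is the deterministic matrix `Σ_{CV,2}`: its entries are the almost sure limits of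
`(1/n) Tr(M_{CV,2}^{i,j})`. There is at most one such matrix. -/
def IsSigmaCV2 {d p : ℕ} {Ω : Type*} [MeasurableSpace Ω] (P : Measure Ω) (θinf θsup : ℝ)
    (K : (Fin p → ℝ) → E d → ℝ) (v : ℕ → Fin d → ℕ) (ε : ℝ) (X : ℕ → Ω → E d)
    (θ0 : Fin p → ℝ) (S : Matrix (Fin p) (Fin p) ℝ) : Prop :=
  ∀ i j, ∀ᵐ ω ∂P, Tendsto
    (fun n : ℕ =>
      (1 / (n : ℝ)) * (cvHessian θinf θsup K v ε (fun m => X m ω) n θ0 i j).trace)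
    atTop (𝓝 (S i j))

/-- `∑_k λ_k (∂/∂θ_k) K_{θ0}(t)`. -/
def derivComb {d p : ℕ} (θinf θsup : ℝ) (K : (Fin p → ℝ) → E d → ℝ) (θ0 : Fin p → ℝ)
    (lam : Fin p → ℝ) (t : E d) : ℝ :=
  ∑ k, lam k * partialDeriv θinf θsup k (fun η => K η t) θ0

/-- `D_ε = ⋃_{v ∈ ℤ^d, v ≠ 0} (v + ε C_S)`, where `C_S = {t₁ - t₂ : t₁, t₂ ∈ S}`. -/
def diffSet {d : ℕ} (ε : ℝ) (S : Set (E d)) : Set (E d) :=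
  {t | ∃ v : Fin d → ℤ, v ≠ 0 ∧ ∃ t₁ ∈ S, ∃ t₂ ∈ S, t = latticePoint v + ε • (t₁ - t₂)}

end CrossValidation

end

/-!
The covariance matrices are coercive and bounded uniformly in the sample size and in the
perturbations, since the spectral density is positive and the perturbed grid points stay separated,
and their entries decay. The commutator of such a matrix with a cutoff at scale `s` is therefore
small in operator norm, so that the diagonal entries of `M_{CV,2}` at `v_i` hardly change when the
matrices are restricted to the observation points in a large window around `v_i`. In this
approximation they are one function of the perturbations in a translated window. Averages of such a
function converge by the law of large numbers, the summands being independent as soon as the windows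
are disjoint, and the windows which leave the grid are negligible.

For the positivity, let `G = ∑ λ_k ∂R/∂θ_k`, whose diagonal vanishes. The quadratic form of
`(1/n) Tr M_{CV,2}` at `λ` is at least a constant multiple of the normalized squared Frobenius norm
of `G`. If `∑ λ_k ∂K_{θ0}/∂θ_k` does not vanish identically on `D_ε`, then one entry of `G` in a
window around each point is bounded away from zero with positive probability, and the limit of these
averages is positive.
-/

namespace CrossValidation

open scoped Matrix.Norms.L2Operator

/-- The Euclidean norm of a finite family of reals. Matrices carry the corresponding operator
norm. -/
local notation "‖" y "‖₂" => norm (WithLp.toLp 2 y)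

section Euclidean

variable {ι β : Type*} [Fintype ι] [Fintype β]

lemma sq_norm_toLp (y : ι → ℝ) : ‖y‖₂ ^ 2 = ∑ i, y i ^ 2 := by
  simp [EuclideanSpace.norm_sq_eq]

lemma norm_toLp_le_of_sum_sq_le {y : ι → ℝ} {b : ℝ} (hb : 0 ≤ b) (h : ∑ i, y i ^ 2 ≤ b ^ 2) :
    ‖y‖₂ ≤ b :=
  le_of_sq_le_sq ((sq_norm_toLp y).trans_le h) hb

lemma norm_toLp_mono {y z : ι → ℝ} (h : ∀ i, |y i| ≤ |z i|) : ‖y‖₂ ≤ ‖z‖₂ :=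
  norm_toLp_le_of_sum_sq_le (norm_nonneg _) <| by
    rw [sq_norm_toLp]
    exact Finset.sum_le_sum fun i _ => sq_le_sq.2 (h i)

lemma norm_toLp_add_le (y z : ι → ℝ) : ‖y + z‖₂ ≤ ‖y‖₂ + ‖z‖₂ :=
  norm_add_le (WithLp.toLp 2 y) (WithLp.toLp 2 z)

lemma abs_apply_le_norm_toLp (y : ι → ℝ) (i : ι) : |y i| ≤ ‖y‖₂ :=
  PiLp.norm_apply_le (WithLp.toLp 2 y) i

lemma norm_toLp_single_one [DecidableEq ι] (i : ι) : ‖(Pi.single i 1 : ι → ℝ)‖₂ = 1 := by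
  simp

lemma dotProduct_le_norm_mul_norm (y z : ι → ℝ) : y ⬝ᵥ z ≤ ‖y‖₂ * ‖z‖₂ := by
  simpa [EuclideanSpace.inner_eq_star_dotProduct, mul_comm] using
    real_inner_le_norm (WithLp.toLp 2 z) (WithLp.toLp 2 y)

lemma norm_toLp_comp_le {e : β → ι} (he : e.Injective) (y : ι → ℝ) : ‖y ∘ e‖₂ ≤ ‖y‖₂ := by
  classical
  refine norm_toLp_le_of_sum_sq_le (norm_nonneg _) ?_
  calc ∑ b, y (e b) ^ 2 = ∑ i ∈ Finset.univ.image e, y i ^ 2 :=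
        (Finset.sum_image (f := fun i => y i ^ 2) fun _ _ _ _ h => he h).symm
    _ ≤ ∑ i, y i ^ 2 :=
        Finset.sum_le_sum_of_subset_of_nonneg (Finset.subset_univ _) fun i _ _ => sq_nonneg _
    _ = ‖y‖₂ ^ 2 := (sq_norm_toLp y).symm

lemma norm_toLp_extend_zero {e : β → ι} (he : e.Injective) (y : β → ℝ) :
    ‖Function.extend e y 0‖₂ = ‖y‖₂ := by
  refine (sq_eq_sq₀ (norm_nonneg _) (norm_nonneg _)).1 ?_
  rw [sq_norm_toLp, sq_norm_toLp]
  refine (Fintype.sum_of_injective e he _ _ (fun i hi => ?_) fun b => ?_).symm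
  · simp [Function.extend_apply' _ _ _ (by simpa using hi)]
  · rw [he.extend_apply]

variable [DecidableEq ι]

lemma norm_mulVec_le (Q : Matrix ι ι ℝ) (y : ι → ℝ) : ‖Q *ᵥ y‖₂ ≤ ‖Q‖ * ‖y‖₂ :=
  Matrix.l2_opNorm_mulVec Q (WithLp.toLp 2 y)

lemma norm_le_of_forall_norm_mulVec_le {Q : Matrix ι ι ℝ} {C : ℝ} (hC : 0 ≤ C)
    (h : ∀ y, ‖Q *ᵥ y‖₂ ≤ C * ‖y‖₂) : ‖Q‖ ≤ C := by
  rw [Matrix.cstar_norm_def]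
  exact ContinuousLinearMap.opNorm_le_bound _ hC fun y => h y.ofLp

lemma abs_entry_le_norm (Q : Matrix ι ι ℝ) (i j : ι) : |Q i j| ≤ ‖Q‖ := by
  simpa using (abs_apply_le_norm_toLp (Q *ᵥ Pi.single j 1) i).trans (norm_mulVec_le Q _)

lemma norm_row_mul_le (Q R : Matrix ι ι ℝ) (i : ι) : ‖(Q * R) i‖₂ ≤ ‖R‖ * ‖Q i‖₂ := by
  have hrow : (Q * R) i = Rᵀ *ᵥ Q i := by
    rw [Matrix.mulVec_transpose]
    exact Matrix.mul_apply_eq_vecMul Q R i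
  have hnorm : ‖Rᵀ‖ = ‖R‖ := by
    rw [← Matrix.conjTranspose_eq_transpose_of_trivial, Matrix.l2_opNorm_conjTranspose]
  rw [hrow, ← hnorm]
  exact norm_mulVec_le _ _

lemma norm_row_le (R : Matrix ι ι ℝ) (i : ι) : ‖R i‖₂ ≤ ‖R‖ := by
  have hone : (1 : Matrix ι ι ℝ) i = Pi.single i 1 := by
    ext j
    simp [Matrix.one_apply, Pi.single_apply, eq_comm]
  simpa [hone] using norm_row_mul_le 1 R i

/-- Schur's test. -/
lemma norm_le_of_sum_row_le_of_sum_col_le {Q q : Matrix ι ι ℝ} {C : ℝ} (hC : 0 ≤ C)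
    (hq : ∀ i j, |Q i j| ≤ q i j) (hrow : ∀ i, ∑ j, q i j ≤ C) (hcol : ∀ j, ∑ i, q i j ≤ C) :
    ‖Q‖ ≤ C := by
  have hq0 : ∀ i j, 0 ≤ q i j := fun i j => (abs_nonneg _).trans (hq i j)
  refine norm_le_of_forall_norm_mulVec_le hC fun y =>
    norm_toLp_le_of_sum_sq_le (by positivity) ?_
  have hcauchy : ∀ i, (Q *ᵥ y) i ^ 2 ≤ (∑ j, q i j) * ∑ j, q i j * y j ^ 2 := fun i =>
    Finset.sum_sq_le_sum_mul_sum_of_sq_le_mul _ (fun j _ => hq0 i j)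
      (fun j _ => mul_nonneg (hq0 i j) (sq_nonneg _)) fun j _ => by
        have : Q i j ^ 2 ≤ q i j ^ 2 := sq_le_sq.2 ((hq i j).trans (le_abs_self _))
        nlinarith [sq_nonneg (y j)]
  calc ∑ i, (Q *ᵥ y) i ^ 2 ≤ ∑ i, C * ∑ j, q i j * y j ^ 2 :=
        Finset.sum_le_sum fun i _ => (hcauchy i).trans <| mul_le_mul_of_nonneg_right (hrow i) <|
          Finset.sum_nonneg fun j _ => mul_nonneg (hq0 i j) (sq_nonneg _)
    _ = C * ∑ j, (∑ i, q i j) * y j ^ 2 := by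
      rw [← Finset.mul_sum, Finset.sum_comm]
      simp_rw [Finset.sum_mul]
    _ ≤ C * ∑ j, C * y j ^ 2 := by
      gcongr with j
      exact hcol j
    _ = (C * ‖y‖₂) ^ 2 := by
      rw [← Finset.mul_sum, mul_pow, sq_norm_toLp]
      ring

lemma diagonal_lie_apply (w : ι → ℝ) (Q : Matrix ι ι ℝ) (i j : ι) :
    ⁅Matrix.diagonal w, Q⁆ i j = (w i - w j) * Q i j := by
  rw [Ring.lie_def, Matrix.sub_apply, Matrix.diagonal_mul, Matrix.mul_diagonal]
  ring

lemma norm_mul_mulVec_le (w : ι → ℝ) (Q : Matrix ι ι ℝ) (y : ι → ℝ) :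
    ‖w * (Q *ᵥ y)‖₂ ≤ ‖⁅Matrix.diagonal w, Q⁆‖ * ‖y‖₂ + ‖Q‖ * ‖w * y‖₂ := by
  have hdiag : ∀ z : ι → ℝ, Matrix.diagonal w *ᵥ z = w * z := fun z =>
    funext fun i => Matrix.mulVec_diagonal w z i
  have hsplit : w * (Q *ᵥ y) = ⁅Matrix.diagonal w, Q⁆ *ᵥ y + Q *ᵥ (w * y) := by
    rw [Ring.lie_def, Matrix.sub_mulVec, ← Matrix.mulVec_mulVec, ← Matrix.mulVec_mulVec, hdiag,
      hdiag, sub_add_cancel]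
  rw [hsplit]
  exact (norm_toLp_add_le _ _).trans (add_le_add (norm_mulVec_le _ _) (norm_mulVec_le _ _))

end Euclidean

section Coercive

variable {ι β : Type*} [Fintype ι] [Fintype β]

/-- The quadratic form of `R` is bounded below by `c` times the square of the Euclidean norm. -/
def Coercive (c : ℝ) (R : Matrix ι ι ℝ) : Prop := ∀ y, c * ‖y‖₂ ^ 2 ≤ y ⬝ᵥ R *ᵥ y

lemma submatrix_mulVec {e : β → ι} (he : e.Injective) (Q : Matrix ι ι ℝ) (y : β → ℝ) :
    Q.submatrix e e *ᵥ y = (Q *ᵥ Function.extend e y 0) ∘ e := by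
  ext b
  refine Fintype.sum_of_injective e he _ _ (fun i hi => ?_) fun a => ?_
  · simp [Function.extend_apply' _ _ _ (by simpa using hi)]
  · rw [he.extend_apply]
    rfl

lemma Coercive.submatrix {e : β → ι} {R : Matrix ι ι ℝ} {c : ℝ} (hR : Coercive c R)
    (he : e.Injective) : Coercive c (R.submatrix e e) := by
  intro y
  have hform : y ⬝ᵥ R.submatrix e e *ᵥ y
      = Function.extend e y 0 ⬝ᵥ R *ᵥ Function.extend e y 0 := by
    rw [submatrix_mulVec he]
    refine Fintype.sum_of_injective e he _ _ (fun i hi => ?_) fun b => ?_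
    · simp [Function.extend_apply' _ _ _ (by simpa using hi)]
    · rw [he.extend_apply, Function.comp_apply]
  rw [hform, ← norm_toLp_extend_zero he]
  exact hR _

variable {R : Matrix ι ι ℝ} {c : ℝ}

lemma Coercive.norm_le_inv_mul_norm_mulVec (hR : Coercive c R) (hc : 0 < c) (y : ι → ℝ) :
    ‖y‖₂ ≤ c⁻¹ * ‖R *ᵥ y‖₂ := by
  have h := (hR y).trans (dotProduct_le_norm_mul_norm _ _)
  rw [← div_eq_inv_mul, le_div_iff₀ hc]
  rcases (norm_nonneg (WithLp.toLp 2 y)).eq_or_lt with h0 | h0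
  · rw [← h0, zero_mul]
    exact norm_nonneg _
  · nlinarith

lemma Coercive.le_apply_self (hR : Coercive c R) (l : ι) : c ≤ R l l := by
  classical
  simpa using hR (Pi.single l 1)

variable [DecidableEq ι] [DecidableEq β]

lemma norm_submatrix_le {e : β → ι} (he : e.Injective) (Q : Matrix ι ι ℝ) :
    ‖Q.submatrix e e‖ ≤ ‖Q‖ := by
  refine norm_le_of_forall_norm_mulVec_le (norm_nonneg _) fun y => ?_
  rw [submatrix_mulVec he, ← norm_toLp_extend_zero he y]
  exact (norm_toLp_comp_le he _).trans (norm_mulVec_le _ _)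

lemma Coercive.isUnit_det (hR : Coercive c R) (hc : 0 < c) : IsUnit R.det := by
  rw [← Matrix.isUnit_iff_isUnit_det, ← Matrix.mulVec_injective_iff_isUnit]
  intro x y hxy
  have h := hR.norm_le_inv_mul_norm_mulVec hc (x - y)
  rw [Matrix.mulVec_sub, sub_eq_zero.2 hxy, WithLp.toLp_zero, norm_zero, mul_zero] at h
  simpa [sub_eq_zero] using h

lemma Coercive.mulVec_inv (hR : Coercive c R) (hc : 0 < c) (y : ι → ℝ) :
    R *ᵥ (R⁻¹ *ᵥ y) = y := by
  rw [Matrix.mulVec_mulVec, Matrix.mul_nonsing_inv _ (hR.isUnit_det hc), Matrix.one_mulVec]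

lemma Coercive.norm_inv_le (hR : Coercive c R) (hc : 0 < c) : ‖R⁻¹‖ ≤ c⁻¹ := by
  refine norm_le_of_forall_norm_mulVec_le (inv_pos.2 hc).le fun y => ?_
  simpa only [hR.mulVec_inv hc] using hR.norm_le_inv_mul_norm_mulVec hc (R⁻¹ *ᵥ y)

lemma Coercive.inv (hR : Coercive c R) (hc : 0 < c) {C : ℝ} (hC : 0 < C) (hRC : ‖R‖ ≤ C) :
    Coercive (c / C ^ 2) R⁻¹ := by
  intro y
  have hform := hR (R⁻¹ *ᵥ y)
  have hnorm := norm_mulVec_le R (R⁻¹ *ᵥ y)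
  rw [hR.mulVec_inv hc] at hform hnorm
  rw [dotProduct_comm, div_mul_eq_mul_div, div_le_iff₀ (by positivity)]
  calc c * ‖y‖₂ ^ 2 ≤ c * (C * ‖R⁻¹ *ᵥ y‖₂) ^ 2 := by
        gcongr
        exact hnorm.trans (by gcongr)
    _ = c * ‖R⁻¹ *ᵥ y‖₂ ^ 2 * C ^ 2 := by ring
    _ ≤ _ := by gcongr

end Coercive

section LocalCopy

variable {ι β : Type*} [Fintype ι] [Fintype β] [DecidableEq ι] [DecidableEq β]

/-- `A'` is a copy of `A` on a window `β` embedded by `e`, where the weight `w` is at least `1` off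
the window. The commutator of `A` with `w` has norm of order `δ`, and restricting to the window
intertwines `A` and `A'` up to `δ` and up to the mass of the vector where `w` is large. -/
structure LocalCopy (e : β → ι) (w : ι → ℝ) (δ κ : ℝ) (A : Matrix ι ι ℝ) (A' : Matrix β β ℝ) :
    Prop where
  norm_le : ‖A‖ ≤ κ
  norm_le' : ‖A'‖ ≤ κ
  norm_lie_le : ‖⁅Matrix.diagonal w, A⁆‖ ≤ κ * δ
  norm_restrict_le : ∀ y, ‖A' *ᵥ (y ∘ e) - (A *ᵥ y) ∘ e‖₂ ≤ κ * (‖w * y‖₂ + δ * ‖y‖₂)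

variable {e : β → ι} {w : ι → ℝ} {δ κ : ℝ} {A : Matrix ι ι ℝ} {A' : Matrix β β ℝ}

lemma localCopy_submatrix {Q : Matrix ι ι ℝ} (he : e.Injective)
    (hw : ∀ i ∉ Set.range e, 1 ≤ w i) (hδ : 0 ≤ δ) (hκ : ‖Q‖ ≤ κ)
    (hQw : ‖⁅Matrix.diagonal w, Q⁆‖ ≤ κ * δ) : LocalCopy e w δ κ Q (Q.submatrix e e) where
  norm_le := hκ
  norm_le' := (norm_submatrix_le he Q).trans hκ
  norm_lie_le := hQw
  norm_restrict_le y := by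
    have hκ0 : 0 ≤ κ := (norm_nonneg _).trans hκ
    have htail : ‖Function.extend e (y ∘ e) 0 - y‖₂ ≤ ‖w * y‖₂ := norm_toLp_mono fun i => by
      by_cases hi : i ∈ Set.range e
      · obtain ⟨b, rfl⟩ := hi
        simpa [he.extend_apply] using mul_nonneg (abs_nonneg _) (abs_nonneg _)
      · rw [Pi.sub_apply, Function.extend_apply' _ _ _ (by simpa using hi), Pi.zero_apply,
          zero_sub, abs_neg, Pi.mul_apply, abs_mul]
        exact le_mul_of_one_le_left (abs_nonneg _) ((hw i hi).trans (le_abs_self _))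
    have hsplit : Q.submatrix e e *ᵥ (y ∘ e) - (Q *ᵥ y) ∘ e
        = (Q *ᵥ (Function.extend e (y ∘ e) 0 - y)) ∘ e := by
      rw [submatrix_mulVec he, Matrix.mulVec_sub]
      rfl
    calc ‖Q.submatrix e e *ᵥ (y ∘ e) - (Q *ᵥ y) ∘ e‖₂
        ≤ ‖Q‖ * ‖Function.extend e (y ∘ e) 0 - y‖₂ := by
          rw [hsplit]
          exact (norm_toLp_comp_le he _).trans (norm_mulVec_le _ _)
      _ ≤ κ * (‖w * y‖₂ + δ * ‖y‖₂) := by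
          gcongr
          exact htail.trans (le_add_of_nonneg_right (by positivity))

lemma LocalCopy.nonneg (h : LocalCopy e w δ κ A A') : 0 ≤ κ := (norm_nonneg A).trans h.norm_le

lemma LocalCopy.norm_mul_mulVec_le (h : LocalCopy e w δ κ A A') (y : ι → ℝ) :
    ‖w * (A *ᵥ y)‖₂ ≤ κ * (‖w * y‖₂ + δ * ‖y‖₂) := by
  calc ‖w * (A *ᵥ y)‖₂ ≤ ‖⁅Matrix.diagonal w, A⁆‖ * ‖y‖₂ + ‖A‖ * ‖w * y‖₂ :=
        CrossValidation.norm_mul_mulVec_le w A y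
    _ ≤ κ * δ * ‖y‖₂ + κ * ‖w * y‖₂ := by
        gcongr
        exacts [h.norm_lie_le, h.norm_le]
    _ = κ * (‖w * y‖₂ + δ * ‖y‖₂) := by ring

/-- Both the commutator with `w` and the defect of intertwining obey a Leibniz rule. -/
lemma LocalCopy.mul {κ₁ κ₂ : ℝ} {B : Matrix ι ι ℝ} {B' : Matrix β β ℝ} (hδ : 0 ≤ δ)
    (hA : LocalCopy e w δ κ₁ A A') (hB : LocalCopy e w δ κ₂ B B') :
    LocalCopy e w δ (3 * κ₁ * κ₂) (A * B) (A' * B') := by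
  have h₁ := hA.nonneg
  have h₂ := hB.nonneg
  have h₁₂ : 0 ≤ κ₁ * κ₂ := mul_nonneg h₁ h₂
  have hnorm : κ₁ * κ₂ ≤ 3 * κ₁ * κ₂ := by nlinarith
  refine ⟨((norm_mul_le A B).trans (mul_le_mul hA.norm_le hB.norm_le (norm_nonneg _) h₁)).trans
      hnorm, ((norm_mul_le A' B').trans
      (mul_le_mul hA.norm_le' hB.norm_le' (norm_nonneg _) h₁)).trans hnorm, ?_, fun y => ?_⟩
  · have hleibniz : ⁅Matrix.diagonal w, A * B⁆
        = ⁅Matrix.diagonal w, A⁆ * B + A * ⁅Matrix.diagonal w, B⁆ := by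
      simp only [Ring.lie_def]
      noncomm_ring
    calc ‖⁅Matrix.diagonal w, A * B⁆‖
        ≤ ‖⁅Matrix.diagonal w, A⁆‖ * ‖B‖ + ‖A‖ * ‖⁅Matrix.diagonal w, B⁆‖ := by
          rw [hleibniz]
          exact (norm_add_le _ _).trans (add_le_add (norm_mul_le _ _) (norm_mul_le _ _))
      _ ≤ (κ₁ * δ) * κ₂ + κ₁ * (κ₂ * δ) := by
          gcongr
          exacts [hA.norm_lie_le, hB.norm_le, hA.norm_le, hB.norm_lie_le]
      _ ≤ 3 * κ₁ * κ₂ * δ := by nlinarith [mul_nonneg h₁₂ hδ]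
  · have hleibniz : (A' * B') *ᵥ (y ∘ e) - ((A * B) *ᵥ y) ∘ e
        = A' *ᵥ (B' *ᵥ (y ∘ e) - (B *ᵥ y) ∘ e)
          + (A' *ᵥ ((B *ᵥ y) ∘ e) - (A *ᵥ (B *ᵥ y)) ∘ e) := by
      rw [Matrix.mulVec_sub, Matrix.mulVec_mulVec, Matrix.mulVec_mulVec, sub_add_sub_cancel]
    calc ‖(A' * B') *ᵥ (y ∘ e) - ((A * B) *ᵥ y) ∘ e‖₂
        ≤ ‖A'‖ * ‖B' *ᵥ (y ∘ e) - (B *ᵥ y) ∘ e‖₂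
          + κ₁ * (‖w * (B *ᵥ y)‖₂ + δ * ‖B *ᵥ y‖₂) := by
          rw [hleibniz]
          exact (norm_toLp_add_le _ _).trans
            (add_le_add (norm_mulVec_le _ _) (hA.norm_restrict_le _))
      _ ≤ κ₁ * (κ₂ * (‖w * y‖₂ + δ * ‖y‖₂))
          + κ₁ * (κ₂ * (‖w * y‖₂ + δ * ‖y‖₂) + δ * (κ₂ * ‖y‖₂)) := by
          gcongr
          exacts [hA.norm_le', hB.norm_restrict_le y, hB.norm_mul_mulVec_le y,
            (norm_mulVec_le _ _).trans (by gcongr; exact hB.norm_le)]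
      _ ≤ 3 * κ₁ * κ₂ * (‖w * y‖₂ + δ * ‖y‖₂) := by
          nlinarith [mul_nonneg h₁₂ (norm_nonneg (WithLp.toLp 2 (w * y)))]

lemma lie_nonsing_inv (hdet : IsUnit A.det) (D : Matrix ι ι ℝ) :
    ⁅D, A⁻¹⁆ = -(A⁻¹ * ⁅D, A⁆ * A⁻¹) := by
  rw [Ring.lie_def, Ring.lie_def, Matrix.mul_sub, Matrix.sub_mul, Matrix.mul_assoc,
    Matrix.mul_assoc _ A, Matrix.mul_nonsing_inv _ hdet, Matrix.mul_one, ← Matrix.mul_assoc,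
    Matrix.nonsing_inv_mul _ hdet, Matrix.one_mul, neg_sub]

/-- The constant of a local copy of the inverse, given a bound `K` on the inverses. -/
def invConst (K κ : ℝ) : ℝ := K + K ^ 2 * κ * (K * κ + 1)

/-- The commutator and the defect of intertwining of the inverse are those of the matrix,
multiplied by the inverse on both sides. -/
lemma LocalCopy.inv {K : ℝ} (hδ : 0 ≤ δ) (h : LocalCopy e w δ κ A A') (hdet : IsUnit A.det)
    (hdet' : IsUnit A'.det) (hK : ‖A⁻¹‖ ≤ K) (hK' : ‖A'⁻¹‖ ≤ K) :
    LocalCopy e w δ (invConst K κ) A⁻¹ A'⁻¹ := by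
  have hK0 : 0 ≤ K := (norm_nonneg _).trans hK
  have hκ := h.nonneg
  have hnorm : K ≤ invConst K κ := le_add_of_nonneg_right (by positivity)
  have hlie : ‖⁅Matrix.diagonal w, A⁻¹⁆‖ ≤ K * (κ * δ) * K := by
    rw [lie_nonsing_inv hdet, norm_neg]
    refine (norm_mul_le _ _).trans (mul_le_mul ((norm_mul_le _ _).trans ?_) hK (norm_nonneg _)
      (by positivity))
    exact mul_le_mul hK h.norm_lie_le (norm_nonneg _) hK0
  refine ⟨hK.trans hnorm, hK'.trans hnorm, hlie.trans ?_, fun y => ?_⟩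
  · have : K ^ 2 * κ ≤ invConst K κ := by
      rw [invConst]
      nlinarith [mul_nonneg (mul_nonneg (sq_nonneg K) hκ) (mul_nonneg hK0 hκ)]
    nlinarith
  · have hconj : A'⁻¹ *ᵥ (y ∘ e) - (A⁻¹ *ᵥ y) ∘ e
        = -(A'⁻¹ *ᵥ (A' *ᵥ ((A⁻¹ *ᵥ y) ∘ e) - (A *ᵥ (A⁻¹ *ᵥ y)) ∘ e)) := by
      rw [Matrix.mulVec_sub, Matrix.mulVec_mulVec, Matrix.mulVec_mulVec,
        Matrix.nonsing_inv_mul _ hdet', Matrix.mul_nonsing_inv _ hdet, Matrix.one_mulVec,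
        Matrix.one_mulVec, neg_sub]
    have hinv : ‖A⁻¹ *ᵥ y‖₂ ≤ K * ‖y‖₂ := (norm_mulVec_le _ _).trans (by gcongr)
    have htail : ‖w * (A⁻¹ *ᵥ y)‖₂ ≤ K * (κ * δ) * K * ‖y‖₂ + K * ‖w * y‖₂ :=
      (CrossValidation.norm_mul_mulVec_le w A⁻¹ y).trans (by gcongr)
    calc ‖A'⁻¹ *ᵥ (y ∘ e) - (A⁻¹ *ᵥ y) ∘ e‖₂
        ≤ K * (κ * (‖w * (A⁻¹ *ᵥ y)‖₂ + δ * ‖A⁻¹ *ᵥ y‖₂)) := by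
          rw [hconj, WithLp.toLp_neg, norm_neg]
          exact (norm_mulVec_le _ _).trans
            (mul_le_mul hK' (h.norm_restrict_le _) (norm_nonneg _) hK0)
      _ ≤ K * (κ * ((K * (κ * δ) * K * ‖y‖₂ + K * ‖w * y‖₂) + δ * (K * ‖y‖₂))) := by gcongr
      _ = K ^ 2 * κ * (‖w * y‖₂ + (K * κ + 1) * (δ * ‖y‖₂)) := by ring
      _ ≤ K ^ 2 * κ * (K * κ + 1) * (‖w * y‖₂ + δ * ‖y‖₂) := by
          rw [mul_assoc (K ^ 2 * κ), mul_add (K * κ + 1)]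
          gcongr
          exact le_mul_of_one_le_left (norm_nonneg _) (by nlinarith [mul_nonneg hK0 hκ])
      _ ≤ invConst K κ * (‖w * y‖₂ + δ * ‖y‖₂) := by
          gcongr
          exact le_add_of_nonneg_left hK0

lemma LocalCopy.abs_apply_sub_le (h : LocalCopy e w δ κ A A') (he : e.Injective) {b : β}
    (hb : w (e b) = 0) : |A' b b - A (e b) (e b)| ≤ κ * δ := by
  have hcomp : (Pi.single (e b) 1 : ι → ℝ) ∘ e = Pi.single b 1 := by
    ext a
    simp [Pi.single_apply, he.eq_iff]
  have hweight : w * Pi.single (e b) 1 = 0 := by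
    ext i
    by_cases hi : i = e b
    · simp [hi, hb]
    · simp [hi]
  have hdiff := (abs_apply_le_norm_toLp _ b).trans (h.norm_restrict_le (Pi.single (e b) 1))
  rw [hcomp, hweight, norm_toLp_single_one, WithLp.toLp_zero, norm_zero, zero_add, mul_one]
    at hdiff
  simpa using hdiff

end LocalCopy

section CVDiag

variable {ι β : Type*} [Fintype ι] [Fintype β] [DecidableEq ι] [DecidableEq β]

/-- The numbers `(R⁻¹)ₗₗ`, `(R⁻¹ G R⁻¹)ₗₗ`, `(R⁻¹ H R⁻¹)ₗₗ` and `(R⁻¹ G R⁻¹ H R⁻¹)ₗₗ`, of which the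
`l`-th diagonal entry of `M_{CV,2}` is a function. -/
noncomputable def cvEntries (R G H : Matrix ι ι ℝ) (l : ι) : ℝ × ℝ × ℝ × ℝ :=
  (R⁻¹ l l, (R⁻¹ * G * R⁻¹) l l, (R⁻¹ * H * R⁻¹) l l, (R⁻¹ * G * R⁻¹ * H * R⁻¹) l l)

/-- A diagonal entry of `M_{CV,2}` as a function of the numbers `cvEntries`. -/
noncomputable def cvFun (q : ℝ × ℝ × ℝ × ℝ) : ℝ :=
  2 * q.2.2.2 / q.1 ^ 2 - 2 * q.2.1 * q.2.2.1 / q.1 ^ 3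

/-- The `l`-th diagonal entry of `M_{CV,2}`, for an arbitrary index type. -/
noncomputable def cvDiag (R G H : Matrix ι ι ℝ) (l : ι) : ℝ := cvFun (cvEntries R G H l)

lemma inv_diagPart {n : ℕ} {A : Matrix (Fin n) (Fin n) ℝ} (h : ∀ l, A l l ≠ 0) :
    (diagPart A)⁻¹ = Matrix.diagonal fun l => (A l l)⁻¹ := by
  refine Matrix.inv_eq_right_inv ?_
  rw [diagPart, Matrix.diagonal_mul_diagonal, ← Matrix.diagonal_one]
  exact congrArg _ (funext fun l => mul_inv_cancel₀ (h l))

lemma trace_cvHessianOf {n : ℕ} {R G H : Matrix (Fin n) (Fin n) ℝ} (h : ∀ l, R⁻¹ l l ≠ 0) :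
    (cvHessianOf R G H).trace = ∑ l, cvDiag R G H l := by
  refine Finset.sum_congr rfl fun l _ => ?_
  have hl := h l
  simp only [cvHessianOf, inv_diagPart h, cvDiag, cvFun, cvEntries]
  simp only [diagPart, Matrix.diagonal_pow, Matrix.diagonal_mul_diagonal, Matrix.diag_apply,
    Matrix.add_apply, Matrix.smul_apply, Matrix.diagonal_mul, smul_eq_mul, Pi.pow_apply]
  field_simp
  ring

lemma cvDiag_comm {R G H : Matrix ι ι ℝ} (hR : Rᵀ = R) (hG : Gᵀ = G) (hH : Hᵀ = H) (l : ι) :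
    cvDiag R G H l = cvDiag R H G l := by
  have hinv : R⁻¹ᵀ = R⁻¹ := by rw [Matrix.transpose_nonsing_inv, hR]
  have htranspose : (R⁻¹ * G * R⁻¹ * H * R⁻¹)ᵀ = R⁻¹ * H * R⁻¹ * G * R⁻¹ := by
    simp only [Matrix.transpose_mul, hinv, hG, hH, Matrix.mul_assoc]
  have hentry := congrFun (congrFun htranspose l) l
  rw [Matrix.transpose_apply] at hentry
  simp only [cvDiag, cvEntries, cvFun, hentry]
  ring

lemma cvDiag_sum_smul {κ : Type*} [Fintype κ] (R : Matrix ι ι ℝ) (G : κ → Matrix ι ι ℝ)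
    (lam : κ → ℝ) (l : ι) :
    cvDiag R (∑ i, lam i • G i) (∑ i, lam i • G i) l
      = ∑ i, ∑ j, lam i * lam j * cvDiag R (G i) (G j) l := by
  have hlin : (R⁻¹ * (∑ i, lam i • G i) * R⁻¹) l l = ∑ i, lam i * (R⁻¹ * G i * R⁻¹) l l := by
    simp [Matrix.mul_sum, Matrix.sum_mul, Matrix.sum_apply]
  have hbilin : (R⁻¹ * (∑ i, lam i • G i) * R⁻¹ * (∑ i, lam i • G i) * R⁻¹) l l
      = ∑ i, ∑ j, lam i * lam j * (R⁻¹ * G i * R⁻¹ * G j * R⁻¹) l l := by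
    rw [Finset.sum_comm]
    simp only [Matrix.sum_mul, Matrix.sum_apply, Matrix.mul_smul, Matrix.smul_mul,
      Matrix.smul_apply, smul_eq_mul, Finset.mul_sum]
    exact Finset.sum_congr rfl fun i _ => Finset.sum_congr rfl fun j _ => by ring
  simp only [cvDiag, cvEntries, cvFun]
  rw [hlin, hbilin, mul_assoc 2 (∑ i, _), Finset.sum_mul_sum]
  simp only [Finset.mul_sum, Finset.sum_div, ← Finset.sum_sub_distrib]
  exact Finset.sum_congr rfl fun i _ => Finset.sum_congr rfl fun j _ => by ring

section Locality

/-- A bound for the numbers `cvEntries` when `‖R⁻¹‖ ≤ c⁻¹` and `‖G‖, ‖H‖ ≤ C`. -/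
noncomputable def entryBound (c C : ℝ) : ℝ :=
  c⁻¹ + c⁻¹ * C * c⁻¹ + c⁻¹ * C * c⁻¹ * C * c⁻¹

/-- A compact set containing the numbers `cvEntries` of all matrices with coercivity constant `c`
and norm bound `C`. On it the first coordinate, which is a denominator, stays away from zero. -/
noncomputable def entryBox (c C : ℝ) : Set (ℝ × ℝ × ℝ × ℝ) :=
  Set.Icc (c / C ^ 2) (entryBound c C) ×ˢ Set.Icc (-entryBound c C) (entryBound c C) ×ˢ
    Set.Icc (-entryBound c C) (entryBound c C) ×ˢ Set.Icc (-entryBound c C) (entryBound c C)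

lemma isCompact_entryBox (c C : ℝ) : IsCompact (entryBox c C) :=
  isCompact_Icc.prod (isCompact_Icc.prod (isCompact_Icc.prod isCompact_Icc))

variable {c C : ℝ}

lemma continuousOn_cvFun (hc : 0 < c) (hC : 0 < C) : ContinuousOn cvFun (entryBox c C) := by
  have hne : ∀ q ∈ entryBox c C, q.1 ≠ 0 := fun q hq =>
    ((by positivity : 0 < c / C ^ 2).trans_le hq.1.1).ne'
  exact ContinuousOn.sub
    (ContinuousOn.div (by fun_prop) (by fun_prop) fun q hq => pow_ne_zero _ (hne q hq))
    (ContinuousOn.div (by fun_prop) (by fun_prop) fun q hq => pow_ne_zero _ (hne q hq))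

lemma Coercive.le_inv_apply_self {R : Matrix ι ι ℝ} (hR : Coercive c R) (hc : 0 < c) (hC : 0 < C)
    (hRC : ‖R‖ ≤ C) (l : ι) : c / C ^ 2 ≤ R⁻¹ l l :=
  (hR.inv hc hC hRC).le_apply_self l

lemma cvEntries_mem_entryBox {R G H : Matrix ι ι ℝ} (hc : 0 < c) (hC : 0 < C)
    (hR : Coercive c R) (hRC : ‖R‖ ≤ C) (hG : ‖G‖ ≤ C) (hH : ‖H‖ ≤ C) (l : ι) :
    cvEntries R G H l ∈ entryBox c C := by
  have hi := hR.norm_inv_le hc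
  have hpos : 0 < c⁻¹ := inv_pos.2 hc
  have h₁ : ∀ {Q : Matrix ι ι ℝ}, ‖Q‖ ≤ C → ‖R⁻¹ * Q * R⁻¹‖ ≤ c⁻¹ * C * c⁻¹ := fun hQ =>
    (norm_mul₃_le).trans (by gcongr)
  have h₂ : ‖R⁻¹ * G * R⁻¹ * H * R⁻¹‖ ≤ c⁻¹ * C * c⁻¹ * C * c⁻¹ :=
    (norm_mul₃_le).trans (by gcongr; exact h₁ hG)
  have hB₀ : c⁻¹ ≤ entryBound c C :=
    (le_add_of_nonneg_right (by positivity)).trans (le_add_of_nonneg_right (by positivity))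
  have hB₁ : c⁻¹ * C * c⁻¹ ≤ entryBound c C :=
    (le_add_of_nonneg_left hpos.le).trans (le_add_of_nonneg_right (by positivity))
  have hB₂ : c⁻¹ * C * c⁻¹ * C * c⁻¹ ≤ entryBound c C := le_add_of_nonneg_left (by positivity)
  have habs : ∀ {Q : Matrix ι ι ℝ} {b : ℝ}, ‖Q‖ ≤ b → b ≤ entryBound c C →
      |Q l l| ≤ entryBound c C := fun hQ hb => (abs_entry_le_norm _ l l).trans (hQ.trans hb)
  exact ⟨⟨hR.le_inv_apply_self hc hC hRC l, (le_abs_self _).trans (habs hi hB₀)⟩,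
    abs_le.1 (habs (h₁ hG) hB₁), abs_le.1 (habs (h₁ hH) hB₁), abs_le.1 (habs h₂ hB₂)⟩

lemma exists_abs_cvDiag_le (hc : 0 < c) (hC : 0 < C) :
    ∃ B, ∀ {ι : Type*} [Fintype ι] [DecidableEq ι] {R G H : Matrix ι ι ℝ}, Coercive c R →
      ‖R‖ ≤ C → ‖G‖ ≤ C → ‖H‖ ≤ C → ∀ l, |cvDiag R G H l| ≤ B := by
  obtain ⟨B, hB⟩ :=
    (isCompact_entryBox c C).exists_bound_of_continuousOn (continuousOn_cvFun hc hC)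
  exact ⟨B, fun hR hRC hG hH l => hB _ (cvEntries_mem_entryBox hc hC hR hRC hG hH l)⟩

/-- The constant of a local copy of each of the products defining `cvEntries`. -/
noncomputable def entryConst (c C : ℝ) : ℝ :=
  invConst c⁻¹ C + 3 * (3 * invConst c⁻¹ C * C) * invConst c⁻¹ C
    + 3 * (3 * (3 * (3 * invConst c⁻¹ C * C) * invConst c⁻¹ C) * C) * invConst c⁻¹ C

lemma dist_cvEntries_le {e : β → ι} {w : ι → ℝ} {δ : ℝ} {R G H : Matrix ι ι ℝ}
    {R' G' H' : Matrix β β ℝ} {b : β} (hc : 0 < c) (hδ : 0 ≤ δ) (he : e.Injective)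
    (hb : w (e b) = 0) (hRc : Coercive c R) (hRc' : Coercive c R')
    (hR : LocalCopy e w δ C R R') (hG : LocalCopy e w δ C G G') (hH : LocalCopy e w δ C H H') :
    dist (cvEntries R' G' H' b) (cvEntries R G H (e b)) ≤ entryConst c C * δ := by
  have hI := hR.inv hδ (hRc.isUnit_det hc) (hRc'.isUnit_det hc) (hRc.norm_inv_le hc)
    (hRc'.norm_inv_le hc)
  have hIG := (hI.mul hδ hG).mul hδ hI
  have hIH := (hI.mul hδ hH).mul hδ hI
  have hIGH := (hIG.mul hδ hH).mul hδ hI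
  have hle : ∀ {κ : ℝ} {A : Matrix ι ι ℝ} {A' : Matrix β β ℝ}, LocalCopy e w δ κ A A' →
      κ ≤ entryConst c C → |A' b b - A (e b) (e b)| ≤ entryConst c C * δ := fun h hκ =>
    (h.abs_apply_sub_le he hb).trans (mul_le_mul_of_nonneg_right hκ hδ)
  have h₀ := hI.nonneg
  have h₁ := hIG.nonneg
  have h₂ := hIGH.nonneg
  simp only [cvEntries, Prod.dist_eq, Real.dist_eq, max_le_iff]
  refine ⟨hle hI ?_, hle hIG ?_, hle hIH ?_, hle hIGH ?_⟩ <;> rw [entryConst] <;> linarith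

lemma exists_abs_cvDiag_sub_le {η : ℝ} (hc : 0 < c) (hC : 0 < C) (hη : 0 < η) :
    ∃ δ₀ > 0, ∀ {ι β : Type*} [Fintype ι] [Fintype β] [DecidableEq ι] [DecidableEq β]
      {e : β → ι} {w : ι → ℝ} {R G H : Matrix ι ι ℝ} {R' G' H' : Matrix β β ℝ} {δ : ℝ} {b : β},
      e.Injective → w (e b) = 0 → 0 ≤ δ → δ ≤ δ₀ → Coercive c R → Coercive c R' →
      LocalCopy e w δ C R R' → LocalCopy e w δ C G G' → LocalCopy e w δ C H H' →
      |cvDiag R' G' H' b - cvDiag R G H (e b)| ≤ η := by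
  obtain ⟨ρ, hρ, hcont⟩ := Metric.uniformContinuousOn_iff.1
    ((isCompact_entryBox c C).uniformContinuousOn_of_continuous (continuousOn_cvFun hc hC)) η hη
  have hκ : 0 < |entryConst c C| + 1 := by positivity
  refine ⟨ρ / 2 / (|entryConst c C| + 1), by positivity, ?_⟩
  intro ι β _ _ _ _ e w R G H R' G' H' δ b he hb hδ hδ₀ hRc hRc' hR hG hH
  have hdist : dist (cvEntries R' G' H' b) (cvEntries R G H (e b)) < ρ :=
    calc dist (cvEntries R' G' H' b) (cvEntries R G H (e b)) ≤ entryConst c C * δ :=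
          dist_cvEntries_le hc hδ he hb hRc hRc' hR hG hH
      _ ≤ δ * (|entryConst c C| + 1) := by nlinarith [le_abs_self (entryConst c C)]
      _ ≤ ρ / 2 := (le_div_iff₀ hκ).1 hδ₀
      _ < ρ := half_lt_self hρ
  exact (hcont _ (cvEntries_mem_entryBox hc hC hRc' hR.norm_le' hG.norm_le' hH.norm_le' b) _
    (cvEntries_mem_entryBox hc hC hRc hR.norm_le hG.norm_le hH.norm_le (e b)) hdist).le

end Locality

section Positivity

variable {R G : Matrix ι ι ℝ} {c C : ℝ}

/-- The scalars for which the diagonal of `R⁻¹ * cvResidual R G` vanishes. -/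
noncomputable def cvRatio (R G : Matrix ι ι ℝ) (l : ι) : ℝ := (R⁻¹ * G * R⁻¹) l l / R⁻¹ l l

/-- The column `l` of this matrix is the projection of the column `l` of `G * R⁻¹` on the
`R⁻¹`-orthogonal complement of the basis vector `l`. -/
noncomputable def cvResidual (R G : Matrix ι ι ℝ) : Matrix ι ι ℝ :=
  G * R⁻¹ - Matrix.diagonal (cvRatio R G)

lemma cvDiag_self_eq (hR : Rᵀ = R) (hG : Gᵀ = G) {l : ι} (hl : R⁻¹ l l ≠ 0) :
    cvDiag R G G l
      = 2 / R⁻¹ l l ^ 2 * ((cvResidual R G)ᵀ * R⁻¹ * cvResidual R G) l l := by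
  have hinv : R⁻¹ᵀ = R⁻¹ := by rw [Matrix.transpose_nonsing_inv, hR]
  have hexpand : ((cvResidual R G)ᵀ * R⁻¹ * cvResidual R G) l l
      = (R⁻¹ * G * R⁻¹ * G * R⁻¹) l l - 2 * cvRatio R G l * (R⁻¹ * G * R⁻¹) l l
        + cvRatio R G l ^ 2 * R⁻¹ l l := by
    have hmatrix : (cvResidual R G)ᵀ * R⁻¹ * cvResidual R G = R⁻¹ * G * R⁻¹ * G * R⁻¹
        - R⁻¹ * G * R⁻¹ * Matrix.diagonal (cvRatio R G)
        - Matrix.diagonal (cvRatio R G) * (R⁻¹ * G * R⁻¹)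
        + Matrix.diagonal (cvRatio R G) * R⁻¹ * Matrix.diagonal (cvRatio R G) := by
      rw [cvResidual, Matrix.transpose_sub, Matrix.transpose_mul, hinv, hG,
        Matrix.diagonal_transpose]
      noncomm_ring
    simp only [hmatrix, Matrix.add_apply, Matrix.sub_apply, Matrix.mul_diagonal,
      Matrix.diagonal_mul]
    ring
  rw [hexpand, cvDiag, cvFun, cvEntries, cvRatio]
  field_simp
  ring

lemma cvDiag_self_ge (hc : 0 < c) (hC : 0 < C) (hR : Rᵀ = R) (hG : Gᵀ = G) (hRC : ‖R‖ ≤ C)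
    (hRc : Coercive c R) (l : ι) :
    2 * c ^ 2 * (c / C ^ 2) * ‖(cvResidual R G)ᵀ l‖₂ ^ 2 ≤ cvDiag R G G l := by
  have hpos : 0 < R⁻¹ l l :=
    (by positivity : 0 < c / C ^ 2).trans_le (hRc.le_inv_apply_self hc hC hRC l)
  have hle : R⁻¹ l l ≤ c⁻¹ :=
    (le_abs_self _).trans ((abs_entry_le_norm _ l l).trans (hRc.norm_inv_le hc))
  have hfactor : 2 * c ^ 2 ≤ 2 / R⁻¹ l l ^ 2 :=
    calc 2 * c ^ 2 = 2 / (c⁻¹) ^ 2 := by field_simp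
      _ ≤ 2 / R⁻¹ l l ^ 2 := by gcongr
  have hform : c / C ^ 2 * ‖(cvResidual R G)ᵀ l‖₂ ^ 2
      ≤ ((cvResidual R G)ᵀ * R⁻¹ * cvResidual R G) l l := by
    refine (hRc.inv hc hC hRC _).trans_eq ?_
    rw [Matrix.mul_assoc, Matrix.mul_apply']
    rfl
  rw [cvDiag_self_eq hR hG hpos.ne', mul_assoc (2 * c ^ 2)]
  exact mul_le_mul hfactor hform (by positivity) (by positivity)

/-- The diagonal of `cvResidual R G * R` is `-cvRatio R G`, which is therefore controlled by the
residual, and so is `G`. -/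
lemma norm_row_le_norm_row_cvResidual (hR : IsUnit R.det) (hR1 : ∀ i, R i i = 1)
    (hG0 : ∀ i, G i i = 0) (hRC : ‖R‖ ≤ C) (i : ι) :
    ‖G i‖₂ ≤ (1 + C) * C * ‖cvResidual R G i‖₂ := by
  have hC : 0 ≤ C := (norm_nonneg _).trans hRC
  have hmul : cvResidual R G * R = G - Matrix.diagonal (cvRatio R G) * R := by
    rw [cvResidual, Matrix.sub_mul, Matrix.mul_assoc, Matrix.nonsing_inv_mul _ hR, Matrix.mul_one]
  have hratio : |cvRatio R G i| ≤ ‖(cvResidual R G * R) i‖₂ := by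
    have hdiag : (cvResidual R G * R) i i = -cvRatio R G i := by
      rw [hmul, Matrix.sub_apply, Matrix.diagonal_mul, hR1, hG0, mul_one, zero_sub]
    rw [← abs_neg, ← hdiag]
    exact abs_apply_le_norm_toLp _ i
  have hrow : G i = (cvResidual R G * R) i + cvRatio R G i • R i := by
    ext j
    simp [hmul, Matrix.diagonal_mul]
  calc ‖G i‖₂ ≤ ‖(cvResidual R G * R) i‖₂ + |cvRatio R G i| * ‖R i‖₂ := by
        conv_lhs => rw [hrow]
        refine (norm_toLp_add_le _ _).trans_eq ?_
        rw [WithLp.toLp_smul, norm_smul, Real.norm_eq_abs]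
    _ ≤ ‖(cvResidual R G * R) i‖₂ + ‖(cvResidual R G * R) i‖₂ * C := by
        gcongr
        exact (norm_row_le R i).trans hRC
    _ = (1 + C) * ‖(cvResidual R G * R) i‖₂ := by ring
    _ ≤ (1 + C) * (C * ‖cvResidual R G i‖₂) := by
        gcongr
        exact (norm_row_mul_le _ R i).trans (by gcongr)
    _ = (1 + C) * C * ‖cvResidual R G i‖₂ := by ring

theorem sum_sq_le_sum_cvDiag (hc : 0 < c) (hC : 0 < C) (hR : Rᵀ = R) (hG : Gᵀ = G)
    (hRC : ‖R‖ ≤ C) (hRc : Coercive c R) (hR1 : ∀ i, R i i = 1) (hG0 : ∀ i, G i i = 0) :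
    2 * c ^ 2 * (c / C ^ 2) / ((1 + C) * C) ^ 2 * ∑ i, ∑ j, G i j ^ 2
      ≤ ∑ l, cvDiag R G G l := by
  have hfrobenius : ∑ i, ‖cvResidual R G i‖₂ ^ 2 = ∑ l, ‖(cvResidual R G)ᵀ l‖₂ ^ 2 := by
    simp only [sq_norm_toLp, Matrix.transpose_apply]
    exact Finset.sum_comm
  have hrows : ∑ i, ∑ j, G i j ^ 2 ≤ ∑ i, ((1 + C) * C * ‖cvResidual R G i‖₂) ^ 2 := by
    simp_rw [← fun i => sq_norm_toLp (G i)]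
    gcongr with i
    exact norm_row_le_norm_row_cvResidual (hRc.isUnit_det hc) hR1 hG0 hRC i
  calc 2 * c ^ 2 * (c / C ^ 2) / ((1 + C) * C) ^ 2 * ∑ i, ∑ j, G i j ^ 2
      ≤ 2 * c ^ 2 * (c / C ^ 2) / ((1 + C) * C) ^ 2
        * ∑ i, ((1 + C) * C * ‖cvResidual R G i‖₂) ^ 2 := by gcongr
    _ = 2 * c ^ 2 * (c / C ^ 2) * ∑ l, ‖(cvResidual R G)ᵀ l‖₂ ^ 2 := by
        simp only [mul_pow _ (norm _), ← Finset.mul_sum, hfrobenius]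
        field_simp
    _ ≤ ∑ l, cvDiag R G G l := by
        rw [Finset.mul_sum]
        exact Finset.sum_le_sum fun l _ => cvDiag_self_ge hc hC hR hG hRC hRc l

end Positivity

end CVDiag

section LawOfLargeNumbers

lemma tendsto_sqrt_atTop : Tendsto Nat.sqrt atTop atTop := by
  refine tendsto_atTop.2 fun b => ?_
  filter_upwards [eventually_ge_atTop (b ^ 2)] with n hn
  exact Nat.le_sqrt'.2 hn

lemma tendsto_div_of_tendsto_sq_div {a : ℕ → ℝ} {B : ℝ}
    (hB : ∀ m n, m ≤ n → |a n - a m| ≤ B * (n - m))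
    (ha : Tendsto (fun m : ℕ => a (m ^ 2) / (m : ℝ) ^ 2) atTop (𝓝 0)) :
    Tendsto (fun n : ℕ => 1 / (n : ℝ) * a n) atTop (𝓝 0) := by
  have hB0 : 0 ≤ B := by simpa using (abs_nonneg _).trans (hB 0 1 zero_le_one)
  have hlim : Tendsto (fun m : ℕ => |a (m ^ 2) / (m : ℝ) ^ 2| + 2 * B / (m : ℝ)) atTop (𝓝 0) := by
    simpa using ha.abs.add (tendsto_const_div_atTop_nhds_zero_nat (2 * B))
  refine squeeze_zero_norm' ?_ (hlim.comp tendsto_sqrt_atTop)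
  filter_upwards [eventually_ge_atTop 1] with n hn
  have hm : (0 : ℝ) < n.sqrt := by exact_mod_cast Nat.sqrt_pos.2 hn
  have hmn : (n.sqrt : ℝ) ^ 2 ≤ n := by exact_mod_cast Nat.sqrt_le' n
  have hnm : (n : ℝ) ≤ (n.sqrt : ℝ) ^ 2 + 2 * n.sqrt := by
    have := Nat.sqrt_le_add n
    exact_mod_cast (by nlinarith : n ≤ n.sqrt ^ 2 + 2 * n.sqrt)
  have hn0 : (0 : ℝ) < n := by exact_mod_cast hn
  have hdiff : |a n| ≤ |a (n.sqrt ^ 2)| + 2 * B * n.sqrt := by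
    have hlip := hB _ _ (Nat.sqrt_le' n)
    push_cast at hlip
    nlinarith [abs_sub_abs_le_abs_sub (a n) (a (n.sqrt ^ 2))]
  rw [Function.comp_apply, Real.norm_eq_abs, abs_mul, abs_of_pos (one_div_pos.2 hn0),
    one_div_mul_eq_div, div_le_iff₀ hn0, abs_div, abs_of_pos (pow_pos hm 2)]
  calc |a n| ≤ |a (n.sqrt ^ 2)| + 2 * B * n.sqrt := hdiff
    _ = (|a (n.sqrt ^ 2)| / (n.sqrt : ℝ) ^ 2 + 2 * B / n.sqrt) * (n.sqrt : ℝ) ^ 2 := by field_simp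
    _ ≤ _ := by gcongr

variable {Ω : Type*} [MeasurableSpace Ω] {P : Measure Ω}

lemma ae_tendsto_zero_of_summable_integral_sq {U : ℕ → Ω → ℝ}
    (hU : ∀ m, Integrable (fun ω => U m ω ^ 2) P) (hs : Summable fun m => ∫ ω, U m ω ^ 2 ∂P) :
    ∀ᵐ ω ∂P, Tendsto (fun m => U m ω) atTop (𝓝 0) := by
  have hmeas : ∀ m, AEMeasurable (fun ω => ENNReal.ofReal (U m ω ^ 2)) P := fun m =>
    (hU m).aestronglyMeasurable.aemeasurable.ennreal_ofReal
  have hsum : ∫⁻ ω, ∑' m, ENNReal.ofReal (U m ω ^ 2) ∂P ≠ ⊤ := by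
    rw [lintegral_tsum hmeas]
    simp_rw [← fun m => ofReal_integral_eq_lintegral_ofReal (hU m)
      (ae_of_all _ fun _ => sq_nonneg _)]
    exact hs.tsum_ofReal_ne_top
  filter_upwards [ae_lt_top' (AEMeasurable.tsum hmeas) hsum] with ω hω
  have hsq : Tendsto (fun m => U m ω ^ 2) atTop (𝓝 0) := by
    have := (ENNReal.tendsto_toReal ENNReal.zero_ne_top).comp
      (ENNReal.tendsto_atTop_zero_of_tsum_ne_top hω.ne)
    simpa [Function.comp_def, ENNReal.toReal_ofReal, sq_nonneg] using this
  refine (tendsto_zero_iff_abs_tendsto_zero _).2 ?_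
  simpa [Function.comp_def, Real.sqrt_sq_eq_abs] using (Real.continuous_sqrt.tendsto 0).comp hsq

variable [IsProbabilityMeasure P] {Y : ℕ → Ω → ℝ} {B : ℝ} {k : ℕ} {J : ℕ → Finset ℕ}

lemma integrable_sq_sum (hm : ∀ i, Measurable (Y i)) (hB : ∀ i ω, |Y i ω| ≤ B) (n : ℕ) :
    Integrable (fun ω => (∑ i ∈ Finset.range n, Y i ω) ^ 2) P := by
  refine Integrable.of_bound (C := (n * B) ^ 2)
    ((Finset.measurable_sum _ fun i _ => hm i).pow_const 2).aestronglyMeasurable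
    (ae_of_all _ fun ω => ?_)
  rw [Real.norm_eq_abs, abs_pow]
  gcongr
  calc |∑ i ∈ Finset.range n, Y i ω| ≤ ∑ i ∈ Finset.range n, |Y i ω| :=
        Finset.abs_sum_le_sum_abs _ _
    _ ≤ n * B := by simpa using Finset.sum_le_card_nsmul (Finset.range n) _ B fun i _ => hB i ω

lemma integral_sq_sum_le (hm : ∀ i, Measurable (Y i)) (hB : ∀ i ω, |Y i ω| ≤ B)
    (hJ : ∀ i, (J i).card ≤ k) (hcov : ∀ i, ∀ j ∉ J i, ∫ ω, Y i ω * Y j ω ∂P = 0) (n : ℕ) :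
    ∫ ω, (∑ i ∈ Finset.range n, Y i ω) ^ 2 ∂P ≤ n * (k * B ^ 2) := by
  have hYY : ∀ i j ω, |Y i ω * Y j ω| ≤ B ^ 2 := fun i j ω => by
    rw [abs_mul, sq]
    exact mul_le_mul (hB i ω) (hB j ω) (abs_nonneg _) ((abs_nonneg _).trans (hB i ω))
  have hint : ∀ i j, Integrable (fun ω => Y i ω * Y j ω) P := fun i j =>
    .of_bound ((hm i).mul (hm j)).aestronglyMeasurable _ (ae_of_all _ (hYY i j))
  have hentry : ∀ i j, ∫ ω, Y i ω * Y j ω ∂P ≤ if j ∈ J i then B ^ 2 else 0 := fun i j => by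
    split_ifs with hj
    · simpa using integral_mono (hint i j) (integrable_const (B ^ 2))
        fun ω => (le_abs_self _).trans (hYY i j ω)
    · exact (hcov i j hj).le
  have hrow : ∀ i, ∑ j ∈ Finset.range n, ∫ ω, Y i ω * Y j ω ∂P ≤ k * B ^ 2 := fun i => by
    refine (Finset.sum_le_sum fun j _ => hentry i j).trans ?_
    rw [← Finset.sum_filter, Finset.sum_const, nsmul_eq_mul]
    gcongr
    exact (Finset.card_le_card fun j hj => (Finset.mem_filter.1 hj).2).trans (hJ i)
  calc ∫ ω, (∑ i ∈ Finset.range n, Y i ω) ^ 2 ∂P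
      = ∑ i ∈ Finset.range n, ∑ j ∈ Finset.range n, ∫ ω, Y i ω * Y j ω ∂P := by
        simp_rw [sq, Finset.sum_mul_sum]
        rw [integral_finsetSum _ fun i _ => integrable_finsetSum _ fun j _ => hint i j]
        exact Finset.sum_congr rfl fun i _ => integral_finsetSum _ fun j _ => hint i j
    _ ≤ n * (k * B ^ 2) := by
        simpa using Finset.sum_le_card_nsmul (Finset.range n) _ _ fun i _ => hrow i

/-- The average over the first `m²` variables has variance `O(m⁻²)`, which is summable, and between
consecutive squares the average hardly changes. -/
theorem ae_tendsto_average_zero (hm : ∀ i, Measurable (Y i)) (hB : ∀ i ω, |Y i ω| ≤ B)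
    (hJ : ∀ i, (J i).card ≤ k) (hcov : ∀ i, ∀ j ∉ J i, ∫ ω, Y i ω * Y j ω ∂P = 0) :
    ∀ᵐ ω ∂P, Tendsto (fun n : ℕ => 1 / (n : ℝ) * ∑ i ∈ Finset.range n, Y i ω) atTop (𝓝 0) := by
  have hvariance : ∀ m : ℕ, ∫ ω, ((∑ i ∈ Finset.range (m ^ 2), Y i ω) / (m : ℝ) ^ 2) ^ 2 ∂P
      ≤ k * B ^ 2 * (1 / (m : ℝ) ^ 2) := fun m => by
    rcases m.eq_zero_or_pos with rfl | hm0
    · simp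
    have hle := integral_sq_sum_le hm hB hJ hcov (m ^ 2)
    push_cast at hle
    simp_rw [div_pow]
    rw [integral_div, div_le_iff₀ (by positivity)]
    refine hle.trans_eq ?_
    field_simp
  have hsquares := ae_tendsto_zero_of_summable_integral_sq (P := P)
    (U := fun m ω => (∑ i ∈ Finset.range (m ^ 2), Y i ω) / (m : ℝ) ^ 2)
    (fun m => by
      simp_rw [div_pow]
      exact (integrable_sq_sum hm hB _).div_const _)
    (.of_nonneg_of_le (fun m => integral_nonneg fun ω => sq_nonneg _) hvariance
      ((Real.summable_one_div_nat_pow.2 one_lt_two).mul_left _))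
  filter_upwards [hsquares] with ω hω
  refine tendsto_div_of_tendsto_sq_div (B := B) (fun m n hmn => ?_) hω
  rw [← Finset.sum_range_add_sum_Ico _ hmn, add_sub_cancel_left]
  refine (Finset.abs_sum_le_sum_abs _ _).trans ((Finset.sum_le_sum fun i _ => hB i ω).trans ?_)
  rw [Finset.sum_const, Nat.card_Ico, nsmul_eq_mul, Nat.cast_sub hmn, mul_comm]

end LawOfLargeNumbers

section Grid

variable {d : ℕ}

/-- The box `{-r, …, r}^d` of relative positions. -/
abbrev Window (d r : ℕ) := ↥(Finset.Icc (fun _ : Fin d => -(r : ℤ)) (fun _ => (r : ℤ)))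

/-- The grid point `v_i` as an integer vector. -/
def site (v : ℕ → Fin d → ℕ) (i : ℕ) : Fin d → ℤ := fun k => (v i k : ℤ)

/-- All the points of the box of radius `r` around `v_i` are grid points. -/
def HasWindow (v : ℕ → Fin d → ℕ) (r i : ℕ) : Prop :=
  ∀ u : Window d r, ∃ j, site v j = site v i + u

/-- All the points of the box of radius `r` around `v_i` are among `v_0, …, v_{n-1}`. -/
def Interior (v : ℕ → Fin d → ℕ) (r n i : ℕ) : Prop :=
  ∀ u : Window d r, ∃ j < n, site v j = site v i + u

/-- The index of the grid point `v_i + u`, arbitrary when this is not a grid point. -/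
noncomputable def translateIndex (v : ℕ → Fin d → ℕ) (i : ℕ) (u : Fin d → ℤ) : ℕ :=
  Function.invFun (site v) (site v i + u)

variable {v : ℕ → Fin d → ℕ} {r n i j : ℕ}

lemma Interior.hasWindow (h : Interior v r n i) : HasWindow v r i := fun u =>
  (h u).imp fun _ => And.right

lemma IsGridEnumeration.injective (hv : IsGridEnumeration v) (hd : 1 ≤ d) :
    Function.Injective v := by
  intro i j hij
  set N := max i j + 1
  have hle : N ≤ N ^ d := Nat.le_self_pow (by lia) N
  have hcube : {u : Fin d → ℕ | ∀ k, 1 ≤ u k ∧ u k ≤ N}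
      = ↑(Fintype.piFinset fun _ : Fin d => Finset.Icc 1 N) := by
    ext u
    simp [Pi.le_def, forall_and]
  have hcard : (v '' Set.Iio (N ^ d)).ncard = (Set.Iio (N ^ d)).ncard := by
    rw [hv N (by lia), hcube, ← Finset.coe_Iio, Set.ncard_coe_finset, Set.ncard_coe_finset]
    simp
  exact Set.injOn_of_ncard_image_eq hcard (Set.finite_Iio _)
    (lt_of_lt_of_le (by lia) hle) (lt_of_lt_of_le (by lia) hle) hij

lemma IsGridEnumeration.exists_eq (hv : IsGridEnumeration v) {N : ℕ} (hN : 1 ≤ N)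
    (hn : N ^ d ≤ n) {z : Fin d → ℕ} (hz : ∀ k, 1 ≤ z k ∧ z k ≤ N) : ∃ j < n, v j = z := by
  obtain ⟨j, hj, rfl⟩ : z ∈ v '' Set.Iio (N ^ d) := by
    rw [hv N hN]
    exact hz
  exact ⟨j, lt_of_lt_of_le hj hn, rfl⟩

lemma site_injective (hv : Function.Injective v) : Function.Injective (site v) := fun _ _ hij =>
  hv (funext fun k => by simpa [site] using congrFun hij k)

lemma translateIndex_eq (hv : Function.Injective v) {u : Fin d → ℤ}
    (h : site v j = site v i + u) : translateIndex v i u = j := by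
  rw [translateIndex, ← h, Function.leftInverse_invFun (site_injective hv)]

lemma HasWindow.site_translateIndex (h : HasWindow v r i) (u : Window d r) :
    site v (translateIndex v i u) = site v i + u :=
  Function.invFun_eq (h u)

lemma HasWindow.translateIndex_injective (h : HasWindow v r i) :
    Function.Injective fun u : Window d r => translateIndex v i u := fun u w huw =>
  Subtype.ext (add_left_cancel ((h.site_translateIndex u).symm.trans
    ((congrArg (site v) huw).trans (h.site_translateIndex w))))

lemma HasWindow.translateIndex_ne (hv : Function.Injective v) (hi : HasWindow v r i)
    (hj : HasWindow v r j) (h : j ∉ (Finset.Icc (fun _ : Fin d => -((2 * r : ℕ) : ℤ))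
      (fun _ => ((2 * r : ℕ) : ℤ))).image (translateIndex v i)) (u w : Window d r) :
    translateIndex v i u ≠ translateIndex v j w := by
  intro huw
  refine h (Finset.mem_image.2 ⟨u - w, ?_, translateIndex_eq hv ?_⟩)
  · have hu := Finset.mem_Icc.1 u.2
    have hw := Finset.mem_Icc.1 w.2
    simp only [Finset.mem_Icc, Pi.le_def, Pi.sub_apply] at hu hw ⊢
    exact ⟨fun k => by have := hu.1 k; have := hw.2 k; lia,
      fun k => by have := hu.2 k; have := hw.1 k; lia⟩
  · have hu := hi.site_translateIndex u
    rw [huw, hj.site_translateIndex w] at hu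
    rw [← add_sub_assoc, ← hu, add_sub_cancel_right]

lemma IsGridEnumeration.interior (hv : IsGridEnumeration v) {N : ℕ} (hn : N ^ d ≤ n)
    (hN : 1 ≤ N) (hi : ∀ k, r + 1 ≤ v i k ∧ v i k ≤ N - r) : Interior v r n i := by
  rintro ⟨u, hu⟩
  rw [Finset.mem_Icc, Pi.le_def, Pi.le_def] at hu
  obtain ⟨j, hj, hjv⟩ := hv.exists_eq hN hn (z := fun k => ((v i k : ℤ) + u k).toNat) fun k => by
    have := hi k
    have := hu.1 k
    have := hu.2 k
    constructor <;> lia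
  refine ⟨j, hj, funext fun k => ?_⟩
  have := hi k
  have := hu.1 k
  simp only [site, hjv, Pi.add_apply]
  lia

open Classical in
lemma IsGridEnumeration.pow_le_card_interior (hv : IsGridEnumeration v) {N : ℕ} (hN : 1 ≤ N)
    (hn : N ^ d ≤ n) :
    (N - 2 * r) ^ d ≤ ((Finset.range n).filter (Interior v r n)).card := by
  have hsub : (Fintype.piFinset fun _ : Fin d => Finset.Icc (r + 1) (N - r))
      ⊆ ((Finset.range n).filter (Interior v r n)).image v := by
    intro u hu
    have hu' : ∀ k, r + 1 ≤ u k ∧ u k ≤ N - r := fun k =>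
      Finset.mem_Icc.1 (Fintype.mem_piFinset.1 hu k)
    obtain ⟨i, hi, rfl⟩ := hv.exists_eq hN hn (z := u) fun k => by have := hu' k; lia
    exact Finset.mem_image_of_mem _
      (Finset.mem_filter.2 ⟨Finset.mem_range.2 hi, hv.interior hn hN hu'⟩)
  calc (N - 2 * r) ^ d
      = (Fintype.piFinset fun _ : Fin d => Finset.Icc (r + 1) (N - r)).card := by
        rw [Fintype.card_piFinset_const, Nat.card_Icc]
        congr 1
        lia
    _ ≤ _ := (Finset.card_le_card hsub).trans Finset.card_image_le

lemma tendsto_nthRoot_atTop (hd : 1 ≤ d) : Tendsto (Nat.nthRoot d) atTop atTop := by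
  refine tendsto_atTop.2 fun b => ?_
  filter_upwards [eventually_ge_atTop (b ^ d)] with n hn
  exact (Nat.le_nthRoot_iff (by lia)).2 hn

lemma tendsto_one_add_pow_sub_one_sub_pow (r d : ℕ) :
    Tendsto (fun M : ℕ => (1 + 1 / (M : ℝ)) ^ d - (1 - (2 * r : ℝ) / M) ^ d) atTop (𝓝 0) := by
  simpa using ((tendsto_one_div_atTop_nhds_zero_nat.const_add (1 : ℝ)).pow d).sub
    (((tendsto_const_div_atTop_nhds_zero_nat (2 * r : ℝ)).const_sub 1).pow d)

open Classical in
lemma IsGridEnumeration.card_not_interior_le (hv : IsGridEnumeration v) {M : ℕ}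
    (hM : 2 * r + 1 ≤ M) (hn : M ^ d ≤ n) (hn' : n < (M + 1) ^ d) :
    1 / (n : ℝ) * ((Finset.range n).filter fun i => ¬ Interior v r n i).card
      ≤ (1 + 1 / (M : ℝ)) ^ d - (1 - (2 * r : ℝ) / M) ^ d := by
  have hM0 : (0 : ℝ) < M := by exact_mod_cast (by lia : 0 < M)
  have hsplit : (((Finset.range n).filter (Interior v r n)).card : ℝ)
      + ((Finset.range n).filter fun i => ¬ Interior v r n i).card = n := by
    exact_mod_cast (Finset.card_filter_add_card_filter_not _).trans (Finset.card_range n)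
  have hinner : ((M : ℝ) - 2 * r) ^ d ≤ ((Finset.range n).filter (Interior v r n)).card := by
    have h := hv.pow_le_card_interior (r := r) (by lia) hn
    have hcast : ((M - 2 * r : ℕ) : ℝ) = (M : ℝ) - 2 * r := by
      rw [Nat.cast_sub (by lia)]
      push_cast
      ring
    rw [← hcast]
    exact_mod_cast h
  have hnM : (n : ℝ) ≤ ((M : ℝ) + 1) ^ d := by exact_mod_cast hn'.le
  have hMn : (M : ℝ) ^ d ≤ n := by exact_mod_cast hn
  have heq : (1 + 1 / (M : ℝ)) ^ d - (1 - (2 * r : ℝ) / M) ^ d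
      = (((M : ℝ) + 1) ^ d - ((M : ℝ) - 2 * r) ^ d) / (M : ℝ) ^ d := by
    rw [sub_div, ← div_pow, ← div_pow]
    congr 2 <;> field_simp
  rw [heq, one_div_mul_eq_div]
  have hbad : (((Finset.range n).filter fun i => ¬ Interior v r n i).card : ℝ)
      ≤ ((M : ℝ) + 1) ^ d - ((M : ℝ) - 2 * r) ^ d := by linarith
  exact div_le_div₀ ((Nat.cast_nonneg _).trans hbad) hbad (by positivity) hMn

open Classical in
lemma IsGridEnumeration.tendsto_card_not_interior (hv : IsGridEnumeration v) (hd : 1 ≤ d)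
    (r : ℕ) :
    Tendsto (fun n : ℕ => 1 / (n : ℝ) *
      ((Finset.range n).filter fun i => ¬ Interior v r n i).card) atTop (𝓝 0) := by
  have hroot := tendsto_nthRoot_atTop hd
  refine squeeze_zero' (Eventually.of_forall fun n => by positivity) ?_
    ((tendsto_one_add_pow_sub_one_sub_pow r d).comp hroot)
  filter_upwards [hroot.eventually_ge_atTop (2 * r + 1)] with n hn
  exact hv.card_not_interior_le hn (Nat.pow_nthRoot_le (.inl (by lia)))
    (Nat.lt_pow_nthRoot_add_one (by lia) _)

end Grid

section LocalAverages

variable {d r : ℕ} {v : ℕ → Fin d → ℕ}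

/-- The perturbations of the points of the box of radius `r` around `v_i`. -/
noncomputable def patch (v : ℕ → Fin d → ℕ) (r : ℕ) (x : ℕ → E d) (i : ℕ) : Window d r → E d :=
  fun u => x (translateIndex v i u)

open Classical in
/-- The value at `v_i` of the local function `H`, centred when the perturbations have law `L`; it
is `0` at the points too close to the boundary of the orthant. -/
noncomputable def centredValue (v : ℕ → Fin d → ℕ) (L : Measure (E d)) (H : (Window d r → E d) → ℝ)
    (x : ℕ → E d) (i : ℕ) : ℝ :=
  if HasWindow v r i then H (patch v r x i) - ∫ y, H y ∂Measure.pi fun _ => L else 0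

open Classical in
/-- The mean over the first `n` sites of the local function `H`, in which the sites near the
boundary count for `0`. -/
noncomputable def localAverage (v : ℕ → Fin d → ℕ) (H : (Window d r → E d) → ℝ) (x : ℕ → E d)
    (n : ℕ) : ℝ :=
  1 / (n : ℝ) * ∑ i ∈ Finset.range n, if Interior v r n i then H (patch v r x i) else 0

variable {L : Measure (E d)} {H : (Window d r → E d) → ℝ} {B : ℝ}

lemma abs_integral_le_of_abs_le {α : Type*} [MeasurableSpace α] {μ : Measure α}
    [IsProbabilityMeasure μ] {h : α → ℝ} (hB : ∀ y, |h y| ≤ B) : |∫ y, h y ∂μ| ≤ B := by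
  simpa using norm_integral_le_of_norm_le_const (μ := μ) (f := h) (ae_of_all _ hB)

lemma abs_centredValue_le [IsProbabilityMeasure L] (hB : ∀ y, |H y| ≤ B) (x : ℕ → E d) (i : ℕ) :
    |centredValue v L H x i| ≤ 2 * B := by
  have hm := abs_integral_le_of_abs_le (μ := Measure.pi fun _ => L) hB
  unfold centredValue
  split_ifs
  · exact (abs_sub _ _).trans (by linarith [hB (patch v r x i)])
  · simpa using (abs_nonneg _).trans hm

open Classical in
lemma tendsto_localAverage_of_centredValue [IsProbabilityMeasure L] (hd : 1 ≤ d)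
    (hv : IsGridEnumeration v) (hB : ∀ y, |H y| ≤ B) {x : ℕ → E d}
    (hx : Tendsto (fun n : ℕ => 1 / (n : ℝ) * ∑ i ∈ Finset.range n, centredValue v L H x i)
      atTop (𝓝 0)) :
    Tendsto (localAverage v H x) atTop (𝓝 (∫ y, H y ∂Measure.pi fun _ => L)) := by
  set m := ∫ y, H y ∂Measure.pi fun _ : Window d r => L with hm
  have hboundary : Tendsto (fun n : ℕ => 4 * B * (1 / (n : ℝ) *
      ((Finset.range n).filter fun i => ¬ Interior v r n i).card)) atTop (𝓝 0) := by
    simpa using (hv.tendsto_card_not_interior hd r).const_mul (4 * B)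
  have hterm : ∀ n i, |(if Interior v r n i then H (patch v r x i) else 0) - m
      - centredValue v L H x i| ≤ if ¬ Interior v r n i then 4 * B else 0 := fun n i => by
    by_cases hi : Interior v r n i
    · simp [centredValue, hi, hi.hasWindow, hm]
    · rw [if_neg hi, if_pos hi, zero_sub]
      have hmB : |m| ≤ B := abs_integral_le_of_abs_le hB
      refine (abs_sub _ _).trans ?_
      rw [abs_neg]
      linarith [abs_centredValue_le (v := v) (L := L) hB x i, (abs_nonneg m).trans hmB]
  have hrest : Tendsto (fun n : ℕ => 1 / (n : ℝ) * ∑ i ∈ Finset.range n,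
      ((if Interior v r n i then H (patch v r x i) else 0) - m - centredValue v L H x i))
      atTop (𝓝 0) := by
    refine squeeze_zero_norm (fun n => ?_) hboundary
    calc _ ≤ 1 / (n : ℝ) * ∑ i ∈ Finset.range n, if ¬ Interior v r n i then 4 * B else 0 := by
          rw [norm_mul, Real.norm_of_nonneg (by positivity)]
          gcongr
          exact norm_sum_le_of_le _ fun i _ => hterm n i
      _ = _ := by
          rw [← Finset.sum_filter, Finset.sum_const, nsmul_eq_mul]
          ring
  rw [← tendsto_sub_nhds_zero_iff]
  refine ((add_zero (0 : ℝ)) ▸ hx.add hrest).congr' ?_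
  filter_upwards [eventually_ge_atTop 1] with n hn
  simp only [localAverage, Finset.sum_sub_distrib, Finset.sum_const, Finset.card_range,
    nsmul_eq_mul]
  field_simp
  ring

variable {Ω : Type*} [MeasurableSpace Ω] {P : Measure Ω} {X : ℕ → Ω → E d} {i j : ℕ}

lemma indepFun_patch (hXm : ∀ i, Measurable (X i)) (hXind : iIndepFun X P)
    (hij : ∀ u w : Window d r, translateIndex v i u ≠ translateIndex v j w) :
    IndepFun (fun ω => patch v r (X · ω) i) (fun ω => patch v r (X · ω) j) P := by
  classical
  let S (l : ℕ) : Finset ℕ := Finset.univ.image fun u : Window d r => translateIndex v l u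
  let f (l : ℕ) (y : S l → E d) (u : Window d r) : E d :=
    y ⟨translateIndex v l u, Finset.mem_image_of_mem _ (Finset.mem_univ u)⟩
  have hf : ∀ l, Measurable (f l) := fun l => measurable_pi_lambda _ fun _ => measurable_pi_apply _
  have hS : Disjoint (S i) (S j) := by
    simp only [S, Finset.disjoint_left, Finset.mem_image]
    rintro _ ⟨u, -, rfl⟩ ⟨w, -, hw⟩
    exact hij u w hw.symm
  exact (hXind.indepFun_finset _ _ hS hXm).comp (hf i) (hf j)

lemma measurable_patch (hXm : ∀ i, Measurable (X i)) (v : ℕ → Fin d → ℕ) (r i : ℕ) :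
    Measurable fun ω => patch v r (X · ω) i :=
  measurable_pi_lambda _ fun _ => hXm _

lemma measurable_centredValue (hXm : ∀ i, Measurable (X i)) (hH : Measurable H) (i : ℕ) :
    Measurable fun ω => centredValue v L H (X · ω) i := by
  unfold centredValue
  split_ifs
  · exact (hH.comp (measurable_patch hXm v r i)).sub_const _
  · exact measurable_const

variable [IsProbabilityMeasure P]

lemma map_patch (hXm : ∀ i, Measurable (X i)) (hXind : iIndepFun X P)
    (hXlaw : ∀ i, P.map (X i) = L) (hi : HasWindow v r i) :
    P.map (fun ω => patch v r (X · ω) i) = Measure.pi fun _ => L := by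
  have h := (iIndepFun_iff_map_fun_eq_pi_map fun u : Window d r =>
    (hXm (translateIndex v i u)).aemeasurable).1 (hXind.precomp hi.translateIndex_injective)
  simp only [hXlaw] at h
  exact h

lemma integral_centredValue_eq_zero (hXm : ∀ i, Measurable (X i)) (hXind : iIndepFun X P)
    (hXlaw : ∀ i, P.map (X i) = L) (hH : Measurable H) (hB : ∀ y, |H y| ≤ B) (i : ℕ) :
    ∫ ω, centredValue v L H (X · ω) i ∂P = 0 := by
  unfold centredValue
  split_ifs with hi
  · have hpatch := measurable_patch hXm v r i
    have hint : Integrable (fun ω => H (patch v r (X · ω) i)) P :=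
      .of_bound (hH.comp hpatch).aestronglyMeasurable B (ae_of_all _ fun _ => hB _)
    rw [integral_sub hint (integrable_const _), ← integral_map hpatch.aemeasurable
      hH.aestronglyMeasurable, map_patch hXm hXind hXlaw hi]
    simp
  · simp

lemma integral_centredValue_mul_eq_zero (hv : Function.Injective v) (hXm : ∀ i, Measurable (X i))
    (hXind : iIndepFun X P) (hXlaw : ∀ i, P.map (X i) = L) (hH : Measurable H)
    (hB : ∀ y, |H y| ≤ B) (hj : j ∉ (Finset.Icc (fun _ : Fin d => -((2 * r : ℕ) : ℤ))
      (fun _ => ((2 * r : ℕ) : ℤ))).image (translateIndex v i)) :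
    ∫ ω, centredValue v L H (X · ω) i * centredValue v L H (X · ω) j ∂P = 0 := by
  by_cases hiw : HasWindow v r i
  swap
  · simp [centredValue, hiw]
  by_cases hjw : HasWindow v r j
  swap
  · simp [centredValue, hjw]
  have hcentre : Measurable fun y => H y - ∫ z, H z ∂Measure.pi fun _ : Window d r => L :=
    hH.sub_const _
  have hindep := (indepFun_patch hXm hXind (hiw.translateIndex_ne hv hjw hj)).comp hcentre hcentre
  have hmean := integral_centredValue_eq_zero (v := v) hXm hXind hXlaw hH hB i
  simp only [centredValue, hiw, hjw, if_true] at hmean ⊢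
  exact (hindep.integral_mul_eq_mul_integral
    (hcentre.comp (measurable_patch hXm v r i)).aestronglyMeasurable
    (hcentre.comp (measurable_patch hXm v r j)).aestronglyMeasurable).trans
    (mul_eq_zero_of_left hmean _)

variable [IsProbabilityMeasure L]

theorem ae_tendsto_localAverage (hd : 1 ≤ d) (hv : IsGridEnumeration v)
    (hXm : ∀ i, Measurable (X i)) (hXind : iIndepFun X P) (hXlaw : ∀ i, P.map (X i) = L)
    (hH : Measurable H) (hB : ∀ y, |H y| ≤ B) :
    ∀ᵐ ω ∂P, Tendsto (localAverage v H (X · ω)) atTop (𝓝 (∫ y, H y ∂Measure.pi fun _ => L)) := by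
  filter_upwards [ae_tendsto_average_zero (measurable_centredValue hXm hH)
    (fun i ω => abs_centredValue_le hB (X · ω) i) (fun i => Finset.card_image_le)
    (fun i j hj => integral_centredValue_mul_eq_zero (hv.injective hd) hXm hXind hXlaw hH hB hj)]
    with ω hω
  exact tendsto_localAverage_of_centredValue hd hv hB hω

end LocalAverages

section LatticeKernel

variable {d : ℕ} {ε : ℝ}

/-- The weights `((1 - 2ε)‖u‖)^{-(d+1)}` on the lattice, vanishing at the origin: a bound for the
decay in `u` of a covariance function at perturbed sites with difference `u`. -/
noncomputable def latticeWeight (d : ℕ) (ε : ℝ) (u : Fin d → ℤ) : ℝ :=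
  (((1 - 2 * ε) * ‖u‖) ^ (d + 1))⁻¹

/-- The weights `latticeWeight`, with the value `1` at the origin. -/
noncomputable def latticeKernel (d : ℕ) (ε : ℝ) (u : Fin d → ℤ) : ℝ :=
  (if u = 0 then 1 else 0) + latticeWeight d ε u

lemma norm_intCast_pi (u : Fin d → ℤ) : ‖fun k => (u k : ℝ)‖ = ‖u‖ := by
  simp only [Pi.norm_def]
  congr 2

lemma summable_norm_pow_inv_int (d : ℕ) :
    Summable fun u : Fin d → ℤ => (‖u‖ ^ (d + 1))⁻¹ := by
  let b := Pi.basisFun ℝ (Fin d)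
  let Λ : Submodule ℤ (Fin d → ℝ) := Submodule.span ℤ (Set.range b)
  have hrank : Module.finrank ℤ Λ < d + 1 := by simp [ZLattice.rank ℝ Λ]
  have hmem : ∀ u : Fin d → ℤ, (fun k => (u k : ℝ)) ∈ Λ := fun u => by
    have hsum : (fun k => (u k : ℝ)) = ∑ k, u k • b k := by
      ext j
      simp [b, Finset.sum_apply, Pi.single_apply]
    rw [hsum]
    exact Submodule.sum_mem _ fun k _ =>
      Submodule.smul_mem _ _ (Submodule.subset_span (Set.mem_range_self k))
  let f : (Fin d → ℤ) → Λ := fun u => ⟨_, hmem u⟩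
  have hf : Function.Injective f := fun u w huw => funext fun k =>
    Int.cast_injective (congrFun (congrArg Subtype.val huw) k)
  refine ((ZLattice.summable_norm_pow_inv Λ (d + 1) hrank).comp_injective hf).congr fun u => ?_
  simp [f, norm_intCast_pi]

lemma summable_latticeWeight (d : ℕ) (ε : ℝ) : Summable (latticeWeight d ε) := by
  refine ((summable_norm_pow_inv_int d).mul_left (((1 - 2 * ε) ^ (d + 1))⁻¹)).congr fun u => ?_
  rw [latticeWeight, mul_pow, mul_inv]

lemma summable_latticeKernel (d : ℕ) (ε : ℝ) : Summable (latticeKernel d ε) :=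
  (summable_of_hasFiniteSupport ((Set.finite_singleton (0 : Fin d → ℤ)).subset
    (by intro u; simp))).add (summable_latticeWeight d ε)

lemma latticeWeight_nonneg (hε : ε < 1 / 2) (u : Fin d → ℤ) : 0 ≤ latticeWeight d ε u := by
  have : 0 ≤ 1 - 2 * ε := by linarith
  unfold latticeWeight
  positivity

lemma latticeKernel_nonneg (hε : ε < 1 / 2) (u : Fin d → ℤ) : 0 ≤ latticeKernel d ε u :=
  add_nonneg (by split_ifs <;> norm_num) (latticeWeight_nonneg hε u)

/-- The coordinates of the point lie in `[-1, 1]`. -/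
def InCube (x : E d) : Prop := ∀ k, |x k| ≤ 1

lemma mul_norm_le_norm_latticePoint_add (hε : 0 ≤ ε) (hε' : ε < 1 / 2) (u : Fin d → ℤ)
    {x y : E d} (hx : InCube x) (hy : InCube y) :
    (1 - 2 * ε) * ‖u‖ ≤ ‖latticePoint u + ε • (x - y)‖ := by
  have h0 : 0 < 1 - 2 * ε := by linarith
  rw [mul_comm, ← le_div_iff₀ h0, pi_norm_le_iff_of_nonneg (by positivity)]
  intro k
  rw [le_div_iff₀ h0]
  by_cases hk : u k = 0
  · simp [hk]
  refine le_trans ?_ (PiLp.norm_apply_le _ k)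
  have hcoord : (latticePoint u + ε • (x - y)) k = u k + ε * (x k - y k) := by
    simp [latticePoint]
  have hu : (1 : ℝ) ≤ |(u k : ℝ)| := by exact_mod_cast Int.one_le_abs hk
  have hxy : |ε * (x k - y k)| ≤ 2 * ε := by
    rw [abs_mul, abs_of_nonneg hε]
    have := (abs_sub (x k) (y k)).trans (add_le_add (hx k) (hy k))
    nlinarith
  have htri := abs_sub_abs_le_abs_sub (u k : ℝ) (-(ε * (x k - y k)))
  rw [abs_neg, sub_neg_eq_add] at htri
  rw [hcoord, Int.norm_eq_abs, Real.norm_eq_abs]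
  nlinarith

lemma abs_le_mul_latticeKernel (hε : 0 ≤ ε) (hε' : ε < 1 / 2) {g : E d → ℝ} {C : ℝ}
    (hg : ∀ t, |g t| ≤ C / (1 + ‖t‖ ^ (d + 1))) (u : Fin d → ℤ)
    {x y : E d} (hx : InCube x) (hy : InCube y) :
    |g (latticePoint u + ε • (x - y))| ≤ C * latticeKernel d ε u := by
  have h0 : 0 < 1 - 2 * ε := by linarith
  have hC : 0 ≤ C := by simpa using (abs_nonneg _).trans (hg 0)
  refine (hg _).trans ?_
  rw [div_eq_mul_inv]
  gcongr
  by_cases hu : u = 0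
  · rw [latticeKernel, if_pos hu]
    exact (inv_le_one_of_one_le₀ (le_add_of_nonneg_right (by positivity))).trans
      (le_add_of_nonneg_right (latticeWeight_nonneg hε' u))
  · rw [latticeKernel, if_neg hu, zero_add, latticeWeight]
    refine inv_anti₀ (pow_pos (mul_pos h0 (norm_pos_iff.2 hu)) _) ?_
    calc ((1 - 2 * ε) * ‖u‖) ^ (d + 1) ≤ ‖latticePoint u + ε • (x - y)‖ ^ (d + 1) :=
          pow_le_pow_left₀ (by positivity) (mul_norm_le_norm_latticePoint_add hε hε' u hx hy) _
      _ ≤ 1 + ‖latticePoint u + ε • (x - y)‖ ^ (d + 1) := by linarith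

lemma norm_le_tsum_of_abs_le {ι G : Type*} [Fintype ι] [DecidableEq ι] [AddCommGroup G]
    {z : ι → G} (hz : Function.Injective z) {κ : G → ℝ} (hκ : ∀ u, 0 ≤ κ u) (hs : Summable κ)
    {Q : Matrix ι ι ℝ} (hQ : ∀ i j, |Q i j| ≤ κ (z i - z j)) : ‖Q‖ ≤ ∑' u, κ u := by
  refine norm_le_of_sum_row_le_of_sum_col_le (tsum_nonneg hκ) hQ (fun i => ?_) fun j => ?_
  · rw [← tsum_fintype (L := .unconditional _)]
    exact tsum_comp_le_tsum_of_inj hs hκ (i := fun j => z i - z j) fun a b h =>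
      hz (sub_right_injective h)
  · rw [← tsum_fintype (L := .unconditional _)]
    exact tsum_comp_le_tsum_of_inj hs hκ (i := fun i => z i - z j) fun a b h =>
      hz (sub_left_injective h)

/-- A slowly varying weight, which vanishes at the origin and is `1` at distance `s` or more. -/
noncomputable def cutoff (s : ℝ) (u : Fin d → ℤ) : ℝ := min 1 (‖u‖ / s)

variable {s : ℝ}

lemma cutoff_nonneg (hs : 0 < s) (u : Fin d → ℤ) : 0 ≤ cutoff s u :=
  le_min zero_le_one (by positivity)

lemma abs_cutoff_sub_le (hs : 0 < s) (u w : Fin d → ℤ) :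
    |cutoff s u - cutoff s w| ≤ cutoff s (u - w) := by
  refine le_min ?_ ?_
  · have hu : cutoff s u ≤ 1 := min_le_left _ _
    have hw : cutoff s w ≤ 1 := min_le_left _ _
    exact abs_sub_le_iff.2 ⟨by linarith [cutoff_nonneg hs w], by linarith [cutoff_nonneg hs u]⟩
  · refine (abs_min_sub_min_le_max _ _ _ _).trans ?_
    rw [sub_self, abs_zero, ← sub_div, abs_div, abs_of_pos hs]
    refine max_le (by positivity) ?_
    gcongr
    exact abs_norm_sub_norm_le u w

/-- The total mass of the lattice kernel seen through the cutoff: up to a constant, a bound for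
the commutator of a matrix dominated by the kernel with the cutoff. -/
noncomputable def cutoffSum (d : ℕ) (ε s : ℝ) : ℝ :=
  ∑' u : Fin d → ℤ, cutoff s u * latticeKernel d ε u

lemma cutoff_mul_latticeKernel_nonneg (hε' : ε < 1 / 2) (hs : 0 < s) (u : Fin d → ℤ) :
    0 ≤ cutoff s u * latticeKernel d ε u :=
  mul_nonneg (cutoff_nonneg hs u) (latticeKernel_nonneg hε' u)

lemma cutoff_mul_latticeKernel_le (hε' : ε < 1 / 2) (u : Fin d → ℤ) :
    cutoff s u * latticeKernel d ε u ≤ latticeKernel d ε u :=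
  mul_le_of_le_one_left (latticeKernel_nonneg hε' u) (min_le_left _ _)

lemma tendsto_cutoffSum (hε' : ε < 1 / 2) :
    Tendsto (fun r : ℕ => cutoffSum d ε r) atTop (𝓝 0) := by
  have hpointwise : ∀ u : Fin d → ℤ,
      Tendsto (fun r : ℕ => cutoff r u * latticeKernel d ε u) atTop (𝓝 0) := fun u => by
    simpa [cutoff] using ((tendsto_const_nhds (x := (1 : ℝ))).min
      (tendsto_const_div_atTop_nhds_zero_nat ‖u‖)).mul_const (latticeKernel d ε u)
  rw [← tsum_zero (β := Fin d → ℤ)]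
  refine tendsto_tsum_of_dominated_convergence (summable_latticeKernel d ε) hpointwise ?_
  filter_upwards [eventually_ge_atTop 1] with r hr u
  have hr' : (0 : ℝ) < r := by exact_mod_cast hr
  rw [Real.norm_of_nonneg (cutoff_mul_latticeKernel_nonneg hε' hr' u)]
  exact cutoff_mul_latticeKernel_le hε' u

lemma norm_diagonal_cutoff_lie_le {ι : Type*} [Fintype ι] [DecidableEq ι] {z : ι → Fin d → ℤ}
    (hz : Function.Injective z) {C : ℝ} (hε' : ε < 1 / 2) (hs : 0 < s) (hC : 0 ≤ C)
    {Q : Matrix ι ι ℝ} (hQ : ∀ i j, |Q i j| ≤ C * latticeKernel d ε (z i - z j))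
    (a : Fin d → ℤ) :
    ‖⁅Matrix.diagonal fun i => cutoff s (z i - a), Q⁆‖ ≤ C * cutoffSum d ε s := by
  have hnonneg := cutoff_mul_latticeKernel_nonneg (d := d) hε' hs
  have hsum : Summable fun u : Fin d → ℤ => cutoff s u * latticeKernel d ε u :=
    .of_nonneg_of_le hnonneg (cutoff_mul_latticeKernel_le hε') (summable_latticeKernel d ε)
  rw [cutoffSum, ← tsum_mul_left]
  refine norm_le_tsum_of_abs_le hz (fun u => mul_nonneg hC (hnonneg u)) (hsum.mul_left C)
    fun i j => ?_
  rw [diagonal_lie_apply, abs_mul]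
  have hcutoff := abs_cutoff_sub_le hs (z i - a) (z j - a)
  rw [sub_sub_sub_cancel_right] at hcutoff
  calc _ ≤ cutoff s (z i - z j) * (C * latticeKernel d ε (z i - z j)) :=
        mul_le_mul hcutoff (hQ i j) (abs_nonneg _) (cutoff_nonneg hs _)
    _ = _ := by ring

end LatticeKernel

section SpectralKernel

variable {d : ℕ} {ι : Type*} [Fintype ι]

/-- The covariance matrix `(k (t_i - t_j))_{i,j}`. -/
def kernelMatrix {ι : Type*} (k : E d → ℝ) (t : ι → E d) : Matrix ι ι ℝ :=
  Matrix.of fun i j => k (t i - t j)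

/-- The point `z_i + ε x_i`, for an arbitrary family `z` of lattice points. -/
noncomputable def perturbedPoint {ι : Type*} (ε : ℝ) (z : ι → Fin d → ℤ) (x : ι → E d) (i : ι) :
    E d :=
  latticePoint (z i) + ε • x i

/-- The even real function with spectral density `g`. -/
noncomputable def spectralKernel (g : E d → ℝ) (t : E d) : ℝ :=
  ∫ f, g f * Real.cos (inner ℝ f t)

/-- The squared modulus of the trigonometric sum `∑ᵢ yᵢ e^{i f·tᵢ}`. -/
noncomputable def trigSumSq (y : ι → ℝ) (t : ι → E d) (f : E d) : ℝ :=
  (∑ i, y i * Real.cos (inner ℝ f (t i))) ^ 2 + (∑ i, y i * Real.sin (inner ℝ f (t i))) ^ 2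

lemma trigSumSq_nonneg (y : ι → ℝ) (t : ι → E d) (f : E d) : 0 ≤ trigSumSq y t f := by
  unfold trigSumSq
  positivity

lemma trigSumSq_eq_sum (y : ι → ℝ) (t : ι → E d) (f : E d) :
    trigSumSq y t f = ∑ i, ∑ j, y i * y j * Real.cos (inner ℝ f (t i - t j)) := by
  simp_rw [trigSumSq, sq, Finset.sum_mul_sum, ← Finset.sum_add_distrib, inner_sub_right,
    Real.cos_sub]
  exact Finset.sum_congr rfl fun i _ => Finset.sum_congr rfl fun j _ => by ring

variable {g h : E d → ℝ}

lemma integrable_mul_cos (hg : Integrable g) (t : E d) :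
    Integrable fun f => g f * Real.cos (inner ℝ f t) :=
  hg.mul_bdd (c := 1) (by fun_prop) (ae_of_all _ fun f => Real.abs_cos_le_one _)

lemma integrable_mul_trigSumSq (hg : Integrable g) (y : ι → ℝ) (t : ι → E d) :
    Integrable fun f => g f * trigSumSq y t f := by
  simp_rw [trigSumSq_eq_sum, Finset.mul_sum, mul_left_comm (g _)]
  exact integrable_finsetSum _ fun i _ => integrable_finsetSum _ fun j _ =>
    (integrable_mul_cos hg _).const_mul _

lemma dotProduct_kernelMatrix_spectralKernel (hg : Integrable g) (y : ι → ℝ) (t : ι → E d) :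
    y ⬝ᵥ kernelMatrix (spectralKernel g) t *ᵥ y = ∫ f, g f * trigSumSq y t f := by
  simp_rw [trigSumSq_eq_sum, Finset.mul_sum, mul_left_comm (g _)]
  have hint : ∀ i j, Integrable fun f =>
      y i * y j * (g f * Real.cos (inner ℝ f (t i - t j))) := fun i j =>
    (integrable_mul_cos hg _).const_mul _
  rw [integral_finsetSum _ fun i _ => integrable_finsetSum _ fun j _ => hint i j]
  simp_rw [integral_finsetSum Finset.univ fun j _ => hint _ j, integral_const_mul]
  simp only [dotProduct, Matrix.mulVec, kernelMatrix, Matrix.of_apply, Finset.mul_sum,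
    spectralKernel]
  exact Finset.sum_congr rfl fun i _ => Finset.sum_congr rfl fun j _ => by ring

lemma Coercive.kernelMatrix_of_mul_le (hg : Integrable g) (hh : Integrable h) {c δ : ℝ}
    (hδ : 0 ≤ δ) (hgh : ∀ f, δ * g f ≤ h f) {t : ι → E d}
    (hc : Coercive c (kernelMatrix (spectralKernel g) t)) :
    Coercive (δ * c) (kernelMatrix (spectralKernel h) t) := fun y => by
  calc δ * c * ‖y‖₂ ^ 2 = δ * (c * ‖y‖₂ ^ 2) := mul_assoc _ _ _
    _ ≤ δ * ∫ f, g f * trigSumSq y t f := by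
        rw [← dotProduct_kernelMatrix_spectralKernel hg]
        exact mul_le_mul_of_nonneg_left (hc y) hδ
    _ ≤ ∫ f, h f * trigSumSq y t f := by
        rw [← integral_const_mul]
        refine integral_mono ((integrable_mul_trigSumSq hg y t).const_mul δ)
          (integrable_mul_trigSumSq hh y t) fun f => ?_
        simpa only [mul_assoc] using
          mul_le_mul_of_nonneg_right (hgh f) (trigSumSq_nonneg y t f)
    _ = _ := (dotProduct_kernelMatrix_spectralKernel hh y t).symm

lemma spectralKernel_eq_re_fourier (hg : Integrable g) (t : E d) :
    spectralKernel g t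
      = (FourierTransform.fourier (fun f => (g f : ℂ)) ((2 * Real.pi)⁻¹ • t)).re := by
  have hgC : Integrable fun f => (g f : ℂ) := hg.ofReal
  have hint := (Real.fourierIntegral_convergent_iff ((2 * Real.pi)⁻¹ • t)).2 hgC
  rw [Real.fourier_eq, ← Complex.reCLM_apply, ← Complex.reCLM.integral_comp_comm hint]
  refine integral_congr_ae (ae_of_all _ fun f => ?_)
  have hangle : 2 * Real.pi * -inner ℝ f ((2 * Real.pi)⁻¹ • t) = -inner ℝ f t := by
    rw [real_inner_smul_right, mul_neg, mul_inv_cancel_left₀ (by positivity)]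
  simp only [Circle.smul_def, Real.fourierChar_apply, hangle, Complex.reCLM_apply, smul_eq_mul,
    Complex.re_mul_ofReal, Complex.exp_ofReal_mul_I_re, Real.cos_neg, mul_comm (g f)]

lemma exists_norm_pow_mul_abs_spectralKernel_le
    (hg : ContDiff ℝ ((⊤ : ℕ∞) : WithTop ℕ∞) g) (hg' : HasCompactSupport g) (n : ℕ) :
    ∃ C, ∀ t, ‖t‖ ^ n * |spectralKernel g t| ≤ C := by
  let W : SchwartzMap (E d) ℂ := (hg'.comp_left Complex.ofReal_zero).toSchwartzMap
    (Complex.ofRealCLM.contDiff.comp hg)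
  obtain ⟨C, -, hdecay⟩ := (FourierTransform.fourier W).decay n 0
  refine ⟨(2 * Real.pi) ^ n * C, fun t => ?_⟩
  have h := hdecay ((2 * Real.pi)⁻¹ • t)
  rw [norm_iteratedFDeriv_zero, norm_smul, mul_pow, norm_inv,
    Real.norm_of_nonneg (by positivity : 0 ≤ 2 * Real.pi), inv_pow, mul_assoc,
    inv_mul_le_iff₀ (by positivity)] at h
  rw [spectralKernel_eq_re_fourier (hg.continuous.integrable_of_hasCompactSupport hg')]
  exact (mul_le_mul_of_nonneg_left (Complex.abs_re_le_norm _) (by positivity)).trans h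

lemma spectralKernel_comp_inv_smul (g : E d → ℝ) {M : ℝ} (hM : 0 < M) (t : E d) :
    spectralKernel (fun f => g (M⁻¹ • f)) t = M ^ d * spectralKernel g (M • t) := by
  have h := Measure.integral_comp_inv_smul (volume : Measure (E d))
    (fun f => g f * Real.cos (inner ℝ f (M • t))) M
  simp only [real_inner_smul_left, real_inner_smul_right, mul_inv_cancel_left₀ hM.ne',
    finrank_euclideanSpace_fin, abs_of_pos (pow_pos hM d), smul_eq_mul] at h
  simpa only [spectralKernel, real_inner_smul_right] using h

lemma exists_pos_mul_le_of_hasCompactSupport {α : Type*} [TopologicalSpace α] {w h : α → ℝ}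
    (hh : Continuous h) (hpos : ∀ f, 0 < h f) (hw : HasCompactSupport w) (hw1 : ∀ f, w f ≤ 1) :
    ∃ δ > 0, ∀ f, δ * w f ≤ h f := by
  obtain ⟨δ, hδ, hle⟩ := hw.isCompact.exists_forall_le' hh.continuousOn fun f _ => hpos f
  refine ⟨δ, hδ, fun f => ?_⟩
  by_cases hf : f ∈ tsupport w
  · exact (mul_le_of_le_one_right hδ.le (hw1 f)).trans (hle f hf)
  · rw [image_eq_zero_of_notMem_tsupport hf, mul_zero]
    exact (hpos f).le

end SpectralKernel

section SpectralCoercivity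

variable {d : ℕ} {ε : ℝ}

lemma coercive_of_norm_sub_smul_one_le {ι : Type*} [Fintype ι] [DecidableEq ι]
    {A : Matrix ι ι ℝ} {m b : ℝ} (h : ‖A - m • 1‖ ≤ b) : Coercive (m - b) A := fun y => by
  have hsplit : y ⬝ᵥ A *ᵥ y = m * ‖y‖₂ ^ 2 + y ⬝ᵥ (A - m • 1) *ᵥ y := by
    rw [Matrix.sub_mulVec, Matrix.smul_mulVec, Matrix.one_mulVec, dotProduct_sub, dotProduct_smul,
      sq_norm_toLp]
    simp [dotProduct, sq]
  have hrest : -y ⬝ᵥ (A - m • 1) *ᵥ y ≤ b * ‖y‖₂ ^ 2 := by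
    calc -y ⬝ᵥ (A - m • 1) *ᵥ y ≤ ‖-y‖₂ * ‖(A - m • 1) *ᵥ y‖₂ := dotProduct_le_norm_mul_norm _ _
      _ ≤ ‖y‖₂ * (b * ‖y‖₂) := by
          rw [WithLp.toLp_neg, norm_neg]
          gcongr
          exact (norm_mulVec_le _ y).trans (by gcongr)
      _ = b * ‖y‖₂ ^ 2 := by ring
  rw [neg_dotProduct] at hrest
  rw [hsplit]
  linarith

lemma perturbedPoint_sub {ι : Type*} (ε : ℝ) (z : ι → Fin d → ℤ) (x : ι → E d) (i j : ι) :
    perturbedPoint ε z x i - perturbedPoint ε z x j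
      = latticePoint (z i - z j) + ε • (x i - x j) := by
  ext a
  simp [perturbedPoint, latticePoint]
  ring

lemma norm_kernelMatrix_sub_smul_one_le {ι : Type*} [Fintype ι] [DecidableEq ι]
    {z : ι → Fin d → ℤ} {x : ι → E d} (hz : Function.Injective z) (hx : ∀ i, InCube (x i))
    (hε : 0 ≤ ε) (hε' : ε < 1 / 2) {k : E d → ℝ} {C : ℝ} (hk : ∀ t, ‖t‖ ^ (d + 1) * |k t| ≤ C) :
    ‖kernelMatrix k (perturbedPoint ε z x) - k 0 • 1‖ ≤ C * ∑' u, latticeWeight d ε u := by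
  have hC : 0 ≤ C := by simpa using hk 0
  rw [← tsum_mul_left]
  refine norm_le_tsum_of_abs_le hz (fun u => mul_nonneg hC (latticeWeight_nonneg hε' u))
    ((summable_latticeWeight d ε).mul_left C) fun i j => ?_
  rcases eq_or_ne i j with rfl | hij
  · simpa [kernelMatrix] using mul_nonneg hC (latticeWeight_nonneg hε' 0)
  have hnorm := mul_norm_le_norm_latticePoint_add hε hε' (z i - z j) (hx i) (hx j)
  have hpos : 0 < (1 - 2 * ε) * ‖z i - z j‖ :=
    mul_pos (by linarith) (norm_pos_iff.2 (sub_ne_zero.2 (hz.ne hij)))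
  have hentry : (kernelMatrix k (perturbedPoint ε z x) - k 0 • 1) i j
      = k (latticePoint (z i - z j) + ε • (x i - x j)) := by
    simp [kernelMatrix, perturbedPoint_sub, hij]
  rw [hentry, latticeWeight, ← div_eq_mul_inv, le_div_iff₀ (by positivity), mul_comm]
  exact (mul_le_mul_of_nonneg_right (pow_le_pow_left₀ hpos.le hnorm _) (abs_nonneg _)).trans (hk _)

/-- When a bump is dilated by `M`, the value at `0` of its spectral kernel is multiplied by `M ^ d`
while its tail is divided by `M`, so for large `M` the diagonal dominates. -/
lemma exists_bump_coercive (d : ℕ) (hε : 0 ≤ ε) (hε' : ε < 1 / 2) :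
    ∃ w : E d → ℝ, Continuous w ∧ HasCompactSupport w ∧ (∀ f, w f ≤ 1) ∧ ∃ c > 0,
      ∀ {ι : Type*} [Fintype ι] (z : ι → Fin d → ℤ) (x : ι → E d), Function.Injective z →
        (∀ i, InCube (x i)) →
        Coercive c (kernelMatrix (spectralKernel w) (perturbedPoint ε z x)) := by
  let w : ContDiffBump (0 : E d) := ⟨1, 2, one_pos, one_lt_two⟩
  obtain ⟨C, hC⟩ := exists_norm_pow_mul_abs_spectralKernel_le w.contDiff w.hasCompactSupport (d + 1)
  have hC0 : 0 ≤ C := by simpa using hC 0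
  set T := ∑' u : Fin d → ℤ, latticeWeight d ε u
  have hT0 : 0 ≤ T := tsum_nonneg (latticeWeight_nonneg hε')
  have hm : 0 < spectralKernel w 0 := by simpa [spectralKernel] using w.integral_pos
  set m := spectralKernel w 0
  set M := C * T / m + 1
  have hM : 1 ≤ M := le_add_of_nonneg_left (by positivity)
  have hM0 : 0 < M := zero_lt_one.trans_le hM
  have hscale := spectralKernel_comp_inv_smul w hM0
  refine ⟨fun f => w (M⁻¹ • f), w.continuous.comp (continuous_const_smul _),
    w.hasCompactSupport.comp_smul (inv_ne_zero hM0.ne'), fun f => w.le_one,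
    M ^ d * m - C / M * T, ?_, fun {ι} _ z x hz hx => ?_⟩
  · have htail : C / M * T < m := by
      rw [div_mul_eq_mul_div, div_lt_iff₀ hM0, mul_add, mul_div_cancel₀ _ hm.ne']
      linarith
    nlinarith [one_le_pow₀ hM (n := d)]
  · classical
    have hdecay : ∀ t, ‖t‖ ^ (d + 1) * |spectralKernel (fun f => w (M⁻¹ • f)) t| ≤ C / M :=
      fun t => by
        have h := hC (M • t)
        rw [norm_smul, Real.norm_of_nonneg hM0.le, mul_pow] at h
        rw [hscale, abs_mul, abs_of_pos (pow_pos hM0 d), le_div_iff₀ hM0]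
        refine le_trans (le_of_eq ?_) h
        ring
    have h := coercive_of_norm_sub_smul_one_le
      (norm_kernelMatrix_sub_smul_one_le hz hx hε hε' hdecay)
    rwa [hscale, smul_zero] at h

theorem exists_coercive_kernelMatrix {h : E d → ℝ} (hcont : Continuous h) (hpos : ∀ f, 0 < h f)
    (hint : Integrable h) (hε : 0 ≤ ε) (hε' : ε < 1 / 2) :
    ∃ c > 0, ∀ {ι : Type*} [Fintype ι] (z : ι → Fin d → ℤ) (x : ι → E d),
      Function.Injective z → (∀ i, InCube (x i)) →
      Coercive c (kernelMatrix (spectralKernel h) (perturbedPoint ε z x)) := by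
  obtain ⟨w, hw, hws, hw1, c, hc, hcoercive⟩ := exists_bump_coercive d hε hε'
  obtain ⟨δ, hδ, hle⟩ := exists_pos_mul_le_of_hasCompactSupport hcont hpos hws hw1
  exact ⟨δ * c, mul_pos hδ hc, fun z x hz hx => (hcoercive z x hz hx).kernelMatrix_of_mul_le
    (hw.integrable_of_hasCompactSupport hws) hint hδ.le hle⟩

end SpectralCoercivity

section RegularCovariance

variable {d : ℕ}

lemma continuous_spectralKernel {g : E d → ℝ} (hg : Integrable g) :
    Continuous (spectralKernel g) := by
  refine continuous_of_dominated (bound := fun f => |g f|)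
    (fun t => (integrable_mul_cos hg t).aestronglyMeasurable)
    (fun t => ae_of_all _ fun f => ?_) hg.abs (ae_of_all _ fun f => by fun_prop)
  rw [norm_mul]
  exact mul_le_of_le_one_right (norm_nonneg _) (Real.abs_cos_le_one _)

/-- The regularity of a covariance function or of one of its derivatives in a parameter that
bounds its matrices on perturbed grids; it is stable under linear combinations. -/
structure RegularKernel (C : ℝ) (k : E d → ℝ) : Prop where
  continuous : Continuous k
  even : ∀ t, k (-t) = k t
  decay : ∀ t, |k t| ≤ C / (1 + ‖t‖ ^ (d + 1))

/-- A correlation function whose matrices on the grids perturbed by `ε` are bounded and uniformly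
coercive, whatever the perturbations in the cube. -/
structure RegularCorrelation (ε c C : ℝ) (k : E d → ℝ) : Prop where
  regular : RegularKernel C k
  apply_zero : k 0 = 1
  pos : 0 < c
  coercive : ∀ {ι : Type} [Fintype ι] (z : ι → Fin d → ℤ) (x : ι → E d),
    Function.Injective z → (∀ i, InCube (x i)) → Coercive c (kernelMatrix k (perturbedPoint ε z x))

namespace RegularKernel

variable {C C' : ℝ} {k : E d → ℝ}

lemma mono (hk : RegularKernel C k) (hC : C ≤ C') : RegularKernel C' k :=
  ⟨hk.continuous, hk.even, fun t => (hk.decay t).trans (by gcongr)⟩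

lemma abs_apply_zero_le (hk : RegularKernel C k) : |k 0| ≤ C := by
  simpa using hk.decay 0

lemma abs_apply_le (hk : RegularKernel C k) (t : E d) : |k t| ≤ C :=
  (hk.decay t).trans (div_le_self ((abs_nonneg _).trans hk.abs_apply_zero_le)
    (le_add_of_nonneg_right (by positivity)))

lemma sum_mul {κ : Type*} [Fintype κ] {g : κ → E d → ℝ} (hg : ∀ i, RegularKernel C (g i))
    (lam : κ → ℝ) : RegularKernel ((∑ i, |lam i|) * C) fun t => ∑ i, lam i * g i t where
  continuous := continuous_finsetSum _ fun i _ => (hg i).continuous.const_mul (lam i)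
  even t := by simp only [(hg _).even]
  decay t := by
    rw [mul_div_assoc, Finset.sum_mul]
    refine (Finset.abs_sum_le_sum_abs _ _).trans (Finset.sum_le_sum fun i _ => ?_)
    rw [abs_mul]
    exact mul_le_mul_of_nonneg_left ((hg i).decay t) (abs_nonneg _)

end RegularKernel

lemma RegularCorrelation.mono {ε c C C' : ℝ} {k : E d → ℝ} (hk : RegularCorrelation ε c C k)
    (hC : C ≤ C') : RegularCorrelation ε c C' k :=
  ⟨hk.regular.mono hC, hk.apply_zero, hk.pos, hk.coercive⟩

end RegularCovariance

section ParametricModel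

lemma abs_derivWithin_sub_slope_le {f : ℝ → ℝ} {lo hi a η C : ℝ}
    (hf : DifferentiableOn ℝ f (Set.Icc lo hi))
    (hf' : DifferentiableOn ℝ (derivWithin f (Set.Icc lo hi)) (Set.Icc lo hi))
    (hC : ∀ s ∈ Set.Icc lo hi,
      |derivWithin (derivWithin f (Set.Icc lo hi)) (Set.Icc lo hi) s| ≤ C)
    (ha : a ∈ Set.Icc lo hi) (hη : 0 < η) (haη : a + η ≤ hi) :
    |derivWithin f (Set.Icc lo hi) a - (f (a + η) - f a) / η| ≤ C * η := by
  set I := Set.Icc lo hi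
  set f' := derivWithin f I
  have hsub : Set.Icc a (a + η) ⊆ I := Set.Icc_subset_Icc ha.1 haη
  have hlip : ∀ s ∈ Set.Icc a (a + η), |f' s - f' a| ≤ C * η := fun s hs => by
    refine (Convex.norm_image_sub_le_of_norm_derivWithin_le hf' hC (convex_Icc lo hi) ha
      (hsub hs)).trans (mul_le_mul_of_nonneg_left ?_ ((abs_nonneg _).trans (hC a ha)))
    rw [Real.norm_of_nonneg (sub_nonneg.2 hs.1)]
    linarith [hs.2]
  have hmean : |(f (a + η) - f' a * (a + η)) - (f a - f' a * a)| ≤ C * η * |a + η - a| := by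
    refine Convex.norm_image_sub_le_of_norm_hasDerivWithin_le (f := fun s => f s - f' a * s)
      (fun s hs => ?_) hlip (convex_Icc a (a + η)) (Set.left_mem_Icc.2 (by linarith))
      (Set.right_mem_Icc.2 (by linarith))
    simpa using ((hf s (hsub hs)).hasDerivWithinAt.mono hsub).fun_sub
      ((hasDerivWithinAt_id s _).const_mul (f' a))
  rw [add_sub_cancel_left, abs_of_pos hη] at hmean
  have hrw : f' a - (f (a + η) - f a) / η
      = -((f (a + η) - f' a * (a + η)) - (f a - f' a * a)) / η := by
    field_simp
    ring
  rwa [hrw, abs_div, abs_neg, abs_of_pos hη, div_le_iff₀ hη]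

variable {d p : ℕ} {θinf θsup : ℝ} {K : (Fin p → ℝ) → E d → ℝ} {θ : Fin p → ℝ}

lemma update_mem_paramBox (hθ : θ ∈ paramBox p θinf θsup) (i : Fin p) {s : ℝ}
    (hs : s ∈ Set.Icc θinf θsup) : Function.update θ i s ∈ paramBox p θinf θsup := fun j => by
  rcases eq_or_ne j i with rfl | hj
  · rwa [Function.update_self]
  · rw [Function.update_of_ne hj]
    exact hθ j

lemma derivWithin_update (i : Fin p) (g : (Fin p → ℝ) → ℝ) (θ : Fin p → ℝ) :
    derivWithin (fun s => g (Function.update θ i s)) (Set.Icc θinf θsup)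
      = fun s => partialDeriv θinf θsup i g (Function.update θ i s) := by
  funext s
  simp only [partialDeriv, Function.update_idem, Function.update_self]

lemma partialDeriv_congr (hθ : θ ∈ paramBox p θinf θsup) (i : Fin p) {g h : (Fin p → ℝ) → ℝ}
    (hgh : ∀ ϑ ∈ paramBox p θinf θsup, g ϑ = h ϑ) :
    partialDeriv θinf θsup i g θ = partialDeriv θinf θsup i h θ :=
  derivWithin_congr (fun _ hs => hgh _ (update_mem_paramBox hθ i hs))
    (hgh _ (update_mem_paramBox hθ i (hθ i)))

lemma partialDeriv_apply_zero (hθ : θ ∈ paramBox p θinf θsup)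
    (hcorr : ∀ ϑ ∈ paramBox p θinf θsup, K ϑ 0 = 1) (i : Fin p) :
    partialDeriv θinf θsup i (fun ϑ => K ϑ 0) θ = 0 := by
  rw [partialDeriv_congr hθ i hcorr, partialDeriv, derivWithin_fun_const, Pi.zero_apply]

namespace ModelCondition

variable (hK : ModelCondition d p θinf θsup K) (hθ : θ ∈ paramBox p θinf θsup)
include hK

section Covariance

include hθ

lemma even (t : E d) : K θ (-t) = K θ t := by
  simpa using (hK.stationary θ hθ 2 ![t, 0]).isHermitian.apply 0 1

lemma spectralKernel_re_fourierHat : spectralKernel (fun f => (fourierHat (K θ) f).re) = K θ := by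
  funext t
  have hint : Integrable fun f =>
      fourierHat (K θ) f * Complex.exp (Complex.I * (inner ℝ f t : ℝ)) :=
    (hK.integrable_hat θ hθ).mul_bdd (c := 1) (by fun_prop)
      (ae_of_all _ fun f => by rw [mul_comm, Complex.norm_exp_ofReal_mul_I])
  have hre := congrArg Complex.re (hK.inversion θ hθ t)
  rw [Complex.ofReal_re, ← Complex.reCLM_apply, ← Complex.reCLM.integral_comp_comm hint] at hre
  rw [hre]
  refine integral_congr_ae (ae_of_all _ fun f => ?_)
  simp only [Complex.reCLM_apply, Complex.mul_re, (hK.positive_hat θ hθ f).1, zero_mul, sub_zero,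
    mul_comm Complex.I, Complex.exp_ofReal_mul_I_re]

lemma continuous_cov : Continuous (K θ) := by
  rw [← hK.spectralKernel_re_fourierHat hθ]
  exact continuous_spectralKernel (hK.integrable_hat θ hθ).re

lemma continuous_fourierHat : Continuous (fourierHat (K θ)) := by
  rw [← continuousOn_univ]
  exact hK.continuous_hat.comp (f := fun f : E d => (f, θ)) (by fun_prop)
    fun f _ => ⟨Set.mem_univ _, hθ⟩

end Covariance

include hθ in
lemma exists_abs_partialDeriv_sub_slope_le (i : Fin p) :
    ∃ C, ∀ η > 0, θ i + η ≤ θsup → ∀ t,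
      |partialDeriv θinf θsup i (fun ϑ => K ϑ t) θ
        - (K (Function.update θ i (θ i + η)) t - K θ t) / η| ≤ C * η := by
  obtain ⟨C, hC⟩ := hK.decay [i, i] (by simp)
  have hC0 : 0 ≤ C := by simpa using (abs_nonneg _).trans (hC θ hθ 0)
  refine ⟨C, fun η hη hηs t => ?_⟩
  have hmem := fun s hs => update_mem_paramBox hθ i (s := s) hs
  have h := abs_derivWithin_sub_slope_le (f := fun s => K (Function.update θ i s) t) (lo := θinf)
    (C := C) (fun s hs => ?_) (fun s hs => ?_) (fun s hs => ?_) (hθ i) hη hηs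
  · rwa [Function.update_eq_self] at h
  · simpa [HasPartialAt, iterPartial] using hK.differentiable [] (by simp) i _ (hmem s hs) t
  · rw [derivWithin_update i fun ϑ => K ϑ t]
    simpa [HasPartialAt, iterPartial] using hK.differentiable [i] (by simp) i _ (hmem s hs) t
  · rw [derivWithin_update i fun ϑ => K ϑ t,
      derivWithin_update i (partialDeriv θinf θsup i fun ϑ => K ϑ t)]
    exact (hC _ (hmem s hs) t).trans (div_le_self hC0 (le_add_of_nonneg_right (by positivity)))

include hθ in
/-- The second derivatives being bounded, the difference quotients converge uniformly in `t`. -/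
lemma continuous_partialDeriv {i : Fin p} (hi : θ i < θsup) :
    Continuous fun t => partialDeriv θinf θsup i (fun ϑ => K ϑ t) θ := by
  obtain ⟨C, hC⟩ := hK.exists_abs_partialDeriv_sub_slope_le hθ i
  have hη : ∀ᶠ η in 𝓝[>] (0 : ℝ), 0 < η ∧ θ i + η ≤ θsup := by
    filter_upwards [Ioo_mem_nhdsGT (sub_pos.2 hi)] with η hη
    exact ⟨hη.1, by linarith [hη.2]⟩
  have hunif : TendstoUniformly
      (fun η t => (K (Function.update θ i (θ i + η)) t - K θ t) / η)
      (fun t => partialDeriv θinf θsup i (fun ϑ => K ϑ t) θ) (𝓝[>] 0) := by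
    refine Metric.tendstoUniformly_iff.2 fun ρ hρ => ?_
    have hlim : Tendsto (fun η => C * η) (𝓝[>] 0) (𝓝 0) :=
      tendsto_nhdsWithin_of_tendsto_nhds (by simpa using (continuous_const_mul C).tendsto 0)
    filter_upwards [hη, hlim.eventually (gt_mem_nhds hρ)] with η ⟨hη0, hηs⟩ hlt t
    exact (hC η hη0 hηs t).trans_lt hlt
  refine hunif.continuous (hη.mono fun η ⟨_, hηs⟩ => ?_).frequently
  have hmem : θ i + η ∈ Set.Icc θinf θsup := ⟨by linarith [(hθ i).1], hηs⟩
  exact ((hK.continuous_cov (update_mem_paramBox hθ i hmem)).sub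
    (hK.continuous_cov hθ)).div_const η

include hθ in
lemma exists_regularCorrelation (hcorr : ∀ ϑ ∈ paramBox p θinf θsup, K ϑ 0 = 1) {ε : ℝ}
    (hε : 0 ≤ ε) (hε' : ε < 1 / 2) : ∃ c C, RegularCorrelation ε c C (K θ) := by
  obtain ⟨C, hC⟩ := hK.decay [] (by simp)
  obtain ⟨c, hc, hcoercive⟩ := exists_coercive_kernelMatrix
    (Complex.continuous_re.comp (hK.continuous_fourierHat hθ))
    (fun f => (hK.positive_hat θ hθ f).2) (hK.integrable_hat θ hθ).re hε hε'
  refine ⟨c, C, ⟨hK.continuous_cov hθ, hK.even hθ, hC θ hθ⟩, hcorr θ hθ, hc, ?_⟩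
  rwa [← hK.spectralKernel_re_fourierHat hθ]

lemma exists_regularKernel_partialDeriv (hθ : ∀ i, θinf < θ i ∧ θ i < θsup) :
    ∃ C, ∀ i, RegularKernel C fun t => partialDeriv θinf θsup i (fun ϑ => K ϑ t) θ := by
  have hmem : θ ∈ paramBox p θinf θsup := fun i => ⟨(hθ i).1.le, (hθ i).2.le⟩
  choose C hC using fun i => hK.decay [i] (by simp)
  have hreg : ∀ i, RegularKernel (C i) fun t => partialDeriv θinf θsup i (fun ϑ => K ϑ t) θ :=
    fun i => ⟨hK.continuous_partialDeriv hmem (hθ i).2,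
      fun t => partialDeriv_congr hmem i fun ϑ hϑ => hK.even hϑ t, hC i θ hmem⟩
  exact ⟨∑ i, C i, fun i => (hreg i).mono (Finset.single_le_sum
    (fun j _ => (abs_nonneg _).trans (hreg j).abs_apply_zero_le) (Finset.mem_univ i))⟩

end ModelCondition

end ParametricModel

section KernelMatrix

variable {d : ℕ} {ι : Type*} {k : E d → ℝ}

lemma kernelMatrix_apply_self (k : E d → ℝ) (t : ι → E d) (i : ι) : kernelMatrix k t i i = k 0 := by
  simp [kernelMatrix]

lemma transpose_kernelMatrix (hk : ∀ t, k (-t) = k t) (t : ι → E d) :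
    (kernelMatrix k t)ᵀ = kernelMatrix k t := by
  ext i j
  rw [Matrix.transpose_apply, kernelMatrix, Matrix.of_apply, Matrix.of_apply, ← hk, neg_sub]

lemma sum_smul_kernelMatrix {κ : Type*} [Fintype κ] (g : κ → E d → ℝ) (lam : κ → ℝ)
    (t : ι → E d) :
    ∑ i, lam i • kernelMatrix (g i) t = kernelMatrix (fun s => ∑ i, lam i * g i s) t := by
  ext a b
  simp [kernelMatrix, Matrix.sum_apply]

lemma kernelMatrix_perturbedPoint_apply (k : E d → ℝ) (ε : ℝ) (z : ι → Fin d → ℤ) (x : ι → E d)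
    (i j : ι) :
    kernelMatrix k (perturbedPoint ε z x) i j
      = k (latticePoint (z i - z j) + ε • (x i - x j)) := by
  rw [kernelMatrix, Matrix.of_apply, perturbedPoint_sub]

/-- A common bound for the operator norms of the matrices of the kernels in `RegularKernel C` and,
up to the factor `cutoffSum`, for those of their commutators with cutoffs. -/
noncomputable def opConst (d : ℕ) (ε C : ℝ) : ℝ := C * (1 + ∑' u, latticeKernel d ε u)

variable {ε c C : ℝ} {z : ι → Fin d → ℤ} {x : ι → E d}

lemma RegularCorrelation.opConst_pos (hk : RegularCorrelation ε c C k) (hε' : ε < 1 / 2) :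
    0 < opConst d ε C := by
  have hC : 1 ≤ C := by simpa [hk.apply_zero] using hk.regular.abs_apply_zero_le
  have hsum : 0 ≤ ∑' u : Fin d → ℤ, latticeKernel d ε u := tsum_nonneg (latticeKernel_nonneg hε')
  rw [opConst]
  positivity

namespace RegularKernel

lemma nonneg (hk : RegularKernel C k) : 0 ≤ C := (abs_nonneg _).trans hk.abs_apply_zero_le

lemma abs_kernelMatrix_le (hk : RegularKernel C k) (hε : 0 ≤ ε) (hε' : ε < 1 / 2)
    (hx : ∀ i, InCube (x i)) (i j : ι) :
    |kernelMatrix k (perturbedPoint ε z x) i j| ≤ C * latticeKernel d ε (z i - z j) := by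
  rw [kernelMatrix_perturbedPoint_apply]
  exact abs_le_mul_latticeKernel hε hε' hk.decay _ (hx i) (hx j)

variable [Fintype ι] [DecidableEq ι]

lemma norm_kernelMatrix_le (hk : RegularKernel C k) (hε : 0 ≤ ε) (hε' : ε < 1 / 2)
    (hz : z.Injective) (hx : ∀ i, InCube (x i)) :
    ‖kernelMatrix k (perturbedPoint ε z x)‖ ≤ opConst d ε C := by
  calc ‖kernelMatrix k (perturbedPoint ε z x)‖ ≤ ∑' u : Fin d → ℤ, C * latticeKernel d ε u :=
        norm_le_tsum_of_abs_le hz (fun u => mul_nonneg hk.nonneg (latticeKernel_nonneg hε' u))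
          ((summable_latticeKernel d ε).mul_left C) (hk.abs_kernelMatrix_le hε hε' hx)
    _ ≤ opConst d ε C := by
        rw [tsum_mul_left, opConst]
        exact mul_le_mul_of_nonneg_left (le_add_of_nonneg_left zero_le_one) hk.nonneg

lemma norm_cutoff_lie_kernelMatrix_le (hk : RegularKernel C k) (hε : 0 ≤ ε) (hε' : ε < 1 / 2)
    (hz : z.Injective) (hx : ∀ i, InCube (x i)) {s : ℝ} (hs : 0 < s) (a : Fin d → ℤ) :
    ‖⁅Matrix.diagonal fun i => cutoff s (z i - a), kernelMatrix k (perturbedPoint ε z x)⁆‖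
      ≤ opConst d ε C * cutoffSum d ε s := by
  refine (norm_diagonal_cutoff_lie_le hz hε' hs hk.nonneg (hk.abs_kernelMatrix_le hε hε' hx)
    a).trans ?_
  have hsum : 0 ≤ ∑' u : Fin d → ℤ, latticeKernel d ε u := tsum_nonneg (latticeKernel_nonneg hε')
  have hcutoff : 0 ≤ cutoffSum d ε s := tsum_nonneg (cutoff_mul_latticeKernel_nonneg hε' hs)
  rw [opConst]
  gcongr
  exact le_mul_of_one_le_right hk.nonneg (le_add_of_nonneg_right hsum)

end RegularKernel

end KernelMatrix

section Locality

variable {d : ℕ}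

/-- The centre of the box. -/
def windowZero (d r : ℕ) : Window d r :=
  ⟨0, Finset.mem_Icc.2 ⟨fun _ => by simp, fun _ => by simp⟩⟩

lemma exists_mem_window (u : Fin d → ℤ) : ∃ r : ℕ, u ∈
    Finset.Icc (fun _ : Fin d => -(r : ℤ)) (fun _ => (r : ℤ)) := by
  have hle : ∀ i, (u i).natAbs ≤ ∑ j, (u j).natAbs := fun i =>
    Finset.single_le_sum (f := fun j => (u j).natAbs) (fun _ _ => Nat.zero_le _)
      (Finset.mem_univ i)
  exact ⟨∑ i, (u i).natAbs, Finset.mem_Icc.2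
    ⟨fun i => by have := hle i; lia, fun i => by have := hle i; lia⟩⟩

lemma one_le_cutoff_of_notMem_window {r : ℕ} (hr : 1 ≤ r) {u : Fin d → ℤ}
    (hu : u ∉ Finset.Icc (fun _ : Fin d => -(r : ℤ)) (fun _ => (r : ℤ))) : 1 ≤ cutoff r u := by
  have hr0 : (0 : ℝ) < r := by exact_mod_cast hr
  refine le_min le_rfl ((one_le_div hr0).2 ?_)
  by_contra! hlt
  have hle : ∀ i, |u i| ≤ (r : ℤ) := fun i => by
    have h := (norm_le_pi_norm u i).trans hlt.le
    rw [Int.norm_eq_abs] at h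
    exact_mod_cast h
  exact hu (Finset.mem_Icc.2 ⟨fun i => (abs_le.1 (hle i)).1, fun i => (abs_le.1 (hle i)).2⟩)

/-- The diagonal entry with index `l` of `M_{CV,2}` at the points `z_i + ε x_i`, where the
covariance function is `k` and its derivatives in the two parameters are `g` and `h`. -/
noncomputable def cvDiagAt {ι : Type*} [Fintype ι] [DecidableEq ι] (ε : ℝ) (k g h : E d → ℝ)
    (z : ι → Fin d → ℤ) (x : ι → E d) (l : ι) : ℝ :=
  cvDiag (kernelMatrix k (perturbedPoint ε z x)) (kernelMatrix g (perturbedPoint ε z x))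
    (kernelMatrix h (perturbedPoint ε z x)) l

/-- The embedding in the first `n` indices of the box of radius `r` around an interior point. -/
noncomputable def Interior.embedding {v : ℕ → Fin d → ℕ} {r n l : ℕ} (hl : Interior v r n l)
    (hv : v.Injective) (u : Window d r) : Fin n :=
  ⟨translateIndex v l u, by
    obtain ⟨m, hm, hmv⟩ := hl u
    rwa [translateIndex_eq hv hmv]⟩

section Embedding

variable {v : ℕ → Fin d → ℕ} {r n : ℕ} {l : Fin n} (hl : Interior v r n l) (hv : v.Injective)
include hl hv

lemma Interior.embedding_injective : (hl.embedding hv).Injective := fun _ _ h =>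
  hl.hasWindow.translateIndex_injective (congrArg Fin.val h)

lemma Interior.embedding_windowZero : hl.embedding hv (windowZero d r) = l :=
  Fin.ext (translateIndex_eq hv (add_zero _).symm)

lemma Interior.site_embedding (u : Window d r) :
    site v (hl.embedding hv u) = site v l + u :=
  hl.hasWindow.site_translateIndex u

lemma Interior.submatrix_kernelMatrix (k : E d → ℝ) (ε : ℝ) (x : ℕ → E d) :
    (kernelMatrix k (perturbedPoint ε (fun m : Fin n => site v m) fun m => x m)).submatrix
        (hl.embedding hv) (hl.embedding hv)
      = kernelMatrix k (perturbedPoint ε Subtype.val (patch v r x l)) := by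
  ext u w
  rw [Matrix.submatrix_apply, kernelMatrix_perturbedPoint_apply, kernelMatrix_perturbedPoint_apply,
    hl.site_embedding hv, hl.site_embedding hv, add_sub_add_left_eq_sub]
  rfl

lemma Interior.one_le_cutoff_site_sub (hr : 1 ≤ r) {m : Fin n}
    (hm : m ∉ Set.range (hl.embedding hv)) : 1 ≤ cutoff r (site v m - site v l) :=
  one_le_cutoff_of_notMem_window hr fun hmem => hm
    ⟨⟨_, hmem⟩, Fin.ext (translateIndex_eq hv (add_sub_cancel _ _).symm)⟩

end Embedding

lemma site_val_injective {v : ℕ → Fin d → ℕ} (hv : v.Injective) (n : ℕ) :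
    Function.Injective fun m : Fin n => site v m :=
  (site_injective hv).comp Fin.val_injective

variable {ε c C : ℝ} {k g h : E d → ℝ}

lemma RegularKernel.localCopy {v : ℕ → Fin d → ℕ} {r n : ℕ} {l : Fin n} {x : ℕ → E d}
    (hk : RegularKernel C k) (hε : 0 ≤ ε) (hε' : ε < 1 / 2) (hl : Interior v r n l)
    (hv : v.Injective) (hr : 1 ≤ r) (hx : ∀ m, InCube (x m)) :
    LocalCopy (hl.embedding hv) (fun m => cutoff r (site v m - site v l)) (cutoffSum d ε r)
      (opConst d ε C) (kernelMatrix k (perturbedPoint ε (fun m : Fin n => site v m) fun m => x m))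
      (kernelMatrix k (perturbedPoint ε Subtype.val (patch v r x l))) := by
  have hr0 : (0 : ℝ) < r := by exact_mod_cast hr
  have hz := site_val_injective hv n
  rw [← hl.submatrix_kernelMatrix hv k ε x]
  exact localCopy_submatrix (hl.embedding_injective hv)
    (fun m hm => hl.one_le_cutoff_site_sub hv hr hm)
    (tsum_nonneg (cutoff_mul_latticeKernel_nonneg hε' hr0))
    (hk.norm_kernelMatrix_le hε hε' hz fun m => hx m)
    (hk.norm_cutoff_lie_kernelMatrix_le hε hε' hz (fun m => hx m) hr0 _)

namespace RegularCorrelation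

variable (hk : RegularCorrelation ε c C k) (hg : RegularKernel C g) (hh : RegularKernel C h)
  (hε : 0 ≤ ε) (hε' : ε < 1 / 2)
include hk hg hh hε hε'

lemma exists_abs_cvDiagAt_le :
    ∃ B, ∀ {ι : Type} [Fintype ι] [DecidableEq ι] {z : ι → Fin d → ℤ} {x : ι → E d},
      z.Injective → (∀ i, InCube (x i)) → ∀ l, |cvDiagAt ε k g h z x l| ≤ B := by
  obtain ⟨B, hB⟩ := exists_abs_cvDiag_le hk.pos (hk.opConst_pos hε')
  exact ⟨B, fun hz hx => hB (hk.coercive _ _ hz hx) (hk.regular.norm_kernelMatrix_le hε hε' hz hx)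
    (hg.norm_kernelMatrix_le hε hε' hz hx) (hh.norm_kernelMatrix_le hε hε' hz hx)⟩

theorem exists_abs_cvDiagAt_patch_sub_le {η : ℝ} (hη : 0 < η) :
    ∃ r : ℕ, ∀ {v : ℕ → Fin d → ℕ} {x : ℕ → E d} {n : ℕ} {l : Fin n}, v.Injective →
      (∀ m, InCube (x m)) → Interior v r n l →
      |cvDiagAt ε k g h Subtype.val (patch v r x l) (windowZero d r)
        - cvDiagAt ε k g h (fun m : Fin n => site v m) (fun m => x m) l| ≤ η := by
  obtain ⟨δ₀, hδ₀, hlocal⟩ := exists_abs_cvDiag_sub_le hk.pos (hk.opConst_pos hε') hη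
  obtain ⟨r, hr1, hr⟩ := ((eventually_ge_atTop 1).and
    ((tendsto_cutoffSum (d := d) hε').eventually (gt_mem_nhds hδ₀))).exists
  refine ⟨r, fun {v x n l} hv hx hl => ?_⟩
  have hr0 : (0 : ℝ) < r := by exact_mod_cast hr1
  have hcentre := hl.embedding_windowZero hv
  have hbound := hlocal (hl.embedding_injective hv) (b := windowZero d r)
    (by simp [hcentre, cutoff]) (tsum_nonneg (cutoff_mul_latticeKernel_nonneg hε' hr0)) hr.le
    (hk.coercive _ _ (site_val_injective hv n) fun m => hx m)
    (hk.coercive _ _ Subtype.val_injective fun u => hx _)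
    (hk.regular.localCopy hε hε' hl hv hr1 hx) (hg.localCopy hε hε' hl hv hr1 hx)
    (hh.localCopy hε hε' hl hv hr1 hx)
  rwa [hcentre] at hbound

end RegularCorrelation

end Locality

section Measurability

variable {d r : ℕ}

lemma measurable_matrix_mul_apply {α ι : Type*} [MeasurableSpace α] [Fintype ι]
    {A B : α → Matrix ι ι ℝ} (hA : ∀ i j, Measurable fun a => A a i j)
    (hB : ∀ i j, Measurable fun a => B a i j) (i j : ι) : Measurable fun a => (A a * B a) i j := by
  simp only [Matrix.mul_apply]
  exact Finset.measurable_sum _ fun m _ => (hA i m).mul (hB m j)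

lemma measurable_matrix_inv_apply {α ι : Type*} [TopologicalSpace α] [MeasurableSpace α]
    [OpensMeasurableSpace α] [Fintype ι] [DecidableEq ι] {A : α → Matrix ι ι ℝ} (hA : Continuous A)
    (i j : ι) : Measurable fun a => (A a)⁻¹ i j := by
  simp only [Matrix.inv_def, Ring.inverse_eq_inv', Matrix.smul_apply, smul_eq_mul]
  exact hA.matrix_det.measurable.inv.mul (hA.matrix_adjugate.matrix_elem i j).measurable

lemma continuous_kernelMatrix {ι : Type*} {k : E d → ℝ} (hk : Continuous k) (ε : ℝ)
    (z : ι → Fin d → ℤ) :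
    Continuous fun x : ι → E d => kernelMatrix k (perturbedPoint ε z x) := by
  refine continuous_matrix fun a b => ?_
  simp only [kernelMatrix, perturbedPoint, Matrix.of_apply]
  fun_prop

lemma measurable_cvDiagAt {ι : Type*} [Fintype ι] [DecidableEq ι] {k g h : E d → ℝ}
    (hk : Continuous k) (hg : Continuous g) (hh : Continuous h) (ε : ℝ) (z : ι → Fin d → ℤ)
    (l : ι) : Measurable fun x : ι → E d => cvDiagAt ε k g h z x l := by
  have hinv := measurable_matrix_inv_apply (continuous_kernelMatrix hk ε z)
  have hentry {f : E d → ℝ} (hf : Continuous f) (a b : ι) :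
      Measurable fun x : ι → E d => kernelMatrix f (perturbedPoint ε z x) a b :=
    ((continuous_kernelMatrix hf ε z).matrix_elem a b).measurable
  have hsandwich {f : E d → ℝ} (hf : Continuous f) :=
    measurable_matrix_mul_apply (measurable_matrix_mul_apply hinv (hentry hf)) hinv
  have hproduct := measurable_matrix_mul_apply
    (measurable_matrix_mul_apply (hsandwich hg) (hentry hh)) hinv
  unfold cvDiagAt cvDiag cvEntries cvFun
  exact (((hproduct l l).const_mul 2).div ((hinv l l).pow_const 2)).sub
    ((((hsandwich hg l l).const_mul 2).mul (hsandwich hh l l)).div ((hinv l l).pow_const 3))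

/-- The families of perturbations in the cube. -/
def cubeFamilies (d r : ℕ) : Set (Window d r → E d) := {y | ∀ w, InCube (y w)}

lemma measurableSet_cubeFamilies : MeasurableSet (cubeFamilies d r) := by
  simp only [cubeFamilies, InCube, Set.ofPred_forall]
  exact MeasurableSet.iInter fun w => MeasurableSet.iInter fun a =>
    measurableSet_le (by fun_prop) measurable_const

end Measurability

section AlmostSureLimits

variable {Ω : Type*} [MeasurableSpace Ω] {P : Measure Ω} [IsProbabilityMeasure P]

lemma exists_ae_tendsto {T : ℕ → Ω → ℝ}
    (h : ∀ η > 0, ∃ m : ℝ, ∀ᵐ ω ∂P, ∀ᶠ n in atTop, |T n ω - m| ≤ η) :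
    ∃ S : ℝ, ∀ᵐ ω ∂P, Tendsto (fun n => T n ω) atTop (𝓝 S) := by
  choose m hm using fun q : ℕ => h (1 / ((q : ℝ) + 1)) (by positivity)
  have hall := ae_all_iff.2 hm
  have hclose : ∀ {ω}, (∀ q : ℕ, ∀ᶠ n in atTop, |T n ω - m q| ≤ 1 / ((q : ℝ) + 1)) →
      ∀ δ > 0, ∃ q : ℕ, 1 / ((q : ℝ) + 1) < δ / 2 ∧
        ∃ N, ∀ n ≥ N, |T n ω - m q| ≤ 1 / ((q : ℝ) + 1) := fun hω δ hδ =>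
    let ⟨q, hq⟩ := exists_nat_one_div_lt (half_pos hδ)
    ⟨q, hq, eventually_atTop.1 (hω q)⟩
  obtain ⟨ω₀, h₀⟩ := hall.exists
  have hcauchy : CauchySeq fun n => T n ω₀ := by
    refine Metric.cauchySeq_iff'.2 fun δ hδ => ?_
    obtain ⟨q, hq, N, hN⟩ := hclose h₀ δ hδ
    refine ⟨N, fun n hn => ?_⟩
    rw [Real.dist_eq]
    linarith [abs_sub_le (T n ω₀) (m q) (T N ω₀), hN n hn, hN N le_rfl,
      abs_sub_comm (m q) (T N ω₀)]
  obtain ⟨S, hS⟩ := cauchySeq_tendsto_of_complete hcauchy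
  have hSm : ∀ q : ℕ, |S - m q| ≤ 1 / ((q : ℝ) + 1) := fun q =>
    le_of_tendsto (hS.sub_const (m q)).abs (h₀ q)
  refine ⟨S, hall.mono fun ω hω => Metric.tendsto_atTop.2 fun δ hδ => ?_⟩
  obtain ⟨q, hq, N, hN⟩ := hclose hω δ hδ
  refine ⟨N, fun n hn => ?_⟩
  rw [Real.dist_eq]
  linarith [abs_sub_le (T n ω) (m q) S, hN n hn, hSm q, abs_sub_comm (m q) S]

end AlmostSureLimits

section Cube

variable {d : ℕ} {L : Measure (E d)}

lemma ae_inCube (hL : L.support ⊆ {x | InCube x}) : ∀ᵐ x ∂L, InCube x := by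
  filter_upwards [Measure.support_mem_ae (μ := L)] with x hx using hL hx

lemma ae_mem_cubeFamilies [SigmaFinite L] (hL : L.support ⊆ {x | InCube x}) (r : ℕ) :
    ∀ᵐ y ∂Measure.pi fun _ : Window d r => L, y ∈ cubeFamilies d r :=
  ae_all_iff.2 fun _ => Measure.tendsto_eval_ae_ae.eventually (ae_inCube hL)

lemma ae_forall_inCube {Ω : Type*} [MeasurableSpace Ω] {P : Measure Ω} {X : ℕ → Ω → E d}
    (hL : L.support ⊆ {x | InCube x}) (hXm : ∀ i, Measurable (X i))
    (hXlaw : ∀ i, P.map (X i) = L) : ∀ᵐ ω ∂P, ∀ m, InCube (X m ω) :=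
  ae_all_iff.2 fun m => ae_of_ae_map (hXm m).aemeasurable (by rw [hXlaw]; exact ae_inCube hL)

end Cube

section GridAverages

variable {d r : ℕ} {ε c C : ℝ} {k g h : E d → ℝ} {v : ℕ → Fin d → ℕ}

/-- The average `(1/n) Tr(M_{CV,2})` at the first `n` points of the perturbed grid, where the
covariance function is `k` and its derivatives in the two parameters are `g` and `h`. -/
noncomputable def gridAverage (ε : ℝ) (k g h : E d → ℝ) (v : ℕ → Fin d → ℕ) (x : ℕ → E d) (n : ℕ) :
    ℝ :=
  1 / (n : ℝ) * ∑ l : Fin n, cvDiagAt ε k g h (fun m : Fin n => site v m) (fun m => x m) l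

open Classical in
lemma abs_average_sub_localAverage_le {H : (Window d r → E d) → ℝ} {x : ℕ → E d} {n : ℕ}
    {a : Fin n → ℝ} {δ B : ℝ} (hδ : 0 ≤ δ)
    (hlocal : ∀ l : Fin n, Interior v r n l → |H (patch v r x l) - a l| ≤ δ)
    (hB : ∀ l, |a l| ≤ B) :
    |1 / (n : ℝ) * ∑ l, a l - localAverage v H x n|
      ≤ δ + B * (1 / (n : ℝ) * ((Finset.range n).filter fun i => ¬ Interior v r n i).card) := by
  have hterm : ∀ l : Fin n, |a l - if Interior v r n l then H (patch v r x l) else 0|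
      ≤ δ + if ¬ Interior v r n l then B else 0 := fun l => by
    by_cases hl : Interior v r n l
    · simpa [hl, abs_sub_comm] using hlocal l hl
    · simpa [hl] using (hB l).trans (le_add_of_nonneg_left hδ)
  have hn : 1 / (n : ℝ) * n ≤ 1 := by
    rw [one_div_mul_eq_div]
    exact div_self_le_one _
  calc |1 / (n : ℝ) * ∑ l, a l - localAverage v H x n|
      = 1 / (n : ℝ) * |∑ l : Fin n, (a l - if Interior v r n l then H (patch v r x l) else 0)| := by
        rw [localAverage, Finset.sum_range, ← mul_sub, ← Finset.sum_sub_distrib, abs_mul,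
          abs_of_nonneg (by positivity)]
    _ ≤ 1 / (n : ℝ) * ∑ l : Fin n, (δ + if ¬ Interior v r n l then B else 0) := by
        gcongr
        exact (Finset.abs_sum_le_sum_abs _ _).trans (Finset.sum_le_sum fun l _ => hterm l)
    _ = 1 / (n : ℝ) * n * δ
        + B * (1 / (n : ℝ) * ((Finset.range n).filter fun i => ¬ Interior v r n i).card) := by
        rw [Finset.sum_add_distrib,
          ← Finset.sum_range (fun l => if ¬ Interior v r n l then B else 0), ← Finset.sum_filter]
        simp only [Finset.sum_const, Finset.card_univ, Fintype.card_fin, nsmul_eq_mul]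
        ring
    _ ≤ _ := by
        gcongr
        exact mul_le_of_le_one_left hδ hn

section Limit

variable {Ω : Type*} [MeasurableSpace Ω] {P : Measure Ω} [IsProbabilityMeasure P]
  {L : Measure (E d)} [IsProbabilityMeasure L] {X : ℕ → Ω → E d}

theorem RegularCorrelation.exists_ae_tendsto_gridAverage (hk : RegularCorrelation ε c C k)
    (hg : RegularKernel C g) (hh : RegularKernel C h) (hε : 0 ≤ ε) (hε' : ε < 1 / 2) (hd : 1 ≤ d)
    (hv : IsGridEnumeration v) (hL : L.support ⊆ {x | InCube x}) (hXm : ∀ i, Measurable (X i))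
    (hXind : iIndepFun X P) (hXlaw : ∀ i, P.map (X i) = L) :
    ∃ S, ∀ᵐ ω ∂P, Tendsto (gridAverage ε k g h v (X · ω)) atTop (𝓝 S) := by
  classical
  have hinj := hv.injective hd
  obtain ⟨B, hB⟩ := hk.exists_abs_cvDiagAt_le hg hh hε hε'
  refine exists_ae_tendsto fun η hη => ?_
  have hη3 : 0 < η / 3 := by positivity
  obtain ⟨r, hr⟩ := hk.exists_abs_cvDiagAt_patch_sub_le hg hh hε hε' hη3
  let H : (Window d r → E d) → ℝ := (cubeFamilies d r).indicator fun y =>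
    cvDiagAt ε k g h Subtype.val y (windowZero d r)
  have hH_eq : ∀ {y}, y ∈ cubeFamilies d r →
      H y = cvDiagAt ε k g h Subtype.val y (windowZero d r) := fun hy => Set.indicator_of_mem hy _
  have hH : Measurable H := (measurable_cvDiagAt hk.regular.continuous hg.continuous
    hh.continuous ε _ _).indicator measurableSet_cubeFamilies
  have hHB : ∀ y, |H y| ≤ |B| := fun y => by
    by_cases hy : y ∈ cubeFamilies d r
    · exact hH_eq hy ▸ (hB Subtype.val_injective hy _).trans (le_abs_self B)
    · simp [H, hy]
  refine ⟨∫ y, H y ∂Measure.pi fun _ => L, ?_⟩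
  have hboundary : Tendsto (fun n : ℕ => B * (1 / (n : ℝ) *
      ((Finset.range n).filter fun i => ¬ Interior v r n i).card)) atTop (𝓝 0) := by
    simpa using (hv.tendsto_card_not_interior hd r).const_mul B
  filter_upwards [ae_tendsto_localAverage hd hv hXm hXind hXlaw hH hHB,
    ae_forall_inCube hL hXm hXlaw] with ω hω hcube
  filter_upwards [Metric.tendsto_nhds.1 hω _ hη3, hboundary.eventually (gt_mem_nhds hη3)]
    with n hlocal hfew
  rw [Real.dist_eq] at hlocal
  have hgrid : |gridAverage ε k g h v (X · ω) n - localAverage v H (X · ω) n| ≤ _ :=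
    abs_average_sub_localAverage_le hη3.le
      (fun l hl => hH_eq (y := patch v r (X · ω) l) (fun _ => hcube _) ▸ hr hinj hcube hl)
      (fun l => hB (site_val_injective hinj n) (fun m => hcube m) l)
  linarith [abs_sub_le (gridAverage ε k g h v (X · ω) n) (localAverage v H (X · ω) n)
    (∫ y, H y ∂Measure.pi fun _ => L)]

end Limit

lemma gridAverage_comm (hk : ∀ t, k (-t) = k t) (hg : ∀ t, g (-t) = g t)
    (hh : ∀ t, h (-t) = h t) (ε : ℝ) (v : ℕ → Fin d → ℕ) (x : ℕ → E d) (n : ℕ) :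
    gridAverage ε k g h v x n = gridAverage ε k h g v x n :=
  congrArg _ (Finset.sum_congr rfl fun l _ => cvDiag_comm (transpose_kernelMatrix hk _)
    (transpose_kernelMatrix hg _) (transpose_kernelMatrix hh _) l)

lemma gridAverage_sum_mul {κ : Type*} [Fintype κ] (ε : ℝ) (k : E d → ℝ) (g : κ → E d → ℝ)
    (lam : κ → ℝ) (v : ℕ → Fin d → ℕ) (x : ℕ → E d) (n : ℕ) :
    gridAverage ε k (fun t => ∑ i, lam i * g i t) (fun t => ∑ i, lam i * g i t) v x n
      = ∑ i, ∑ j, lam i * lam j * gridAverage ε k (g i) (g j) v x n := by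
  simp only [gridAverage, cvDiagAt, ← sum_smul_kernelMatrix, cvDiag_sum_smul]
  rw [Finset.sum_comm]
  simp only [Finset.sum_comm (s := (Finset.univ : Finset (Fin n))), Finset.mul_sum, mul_left_comm]

end GridAverages

section Positivity

variable {d r : ℕ} {ε c C D : ℝ} {k f : E d → ℝ} {v : ℕ → Fin d → ℕ}

/-- The square of `f` at the difference of the points `u + ε y_u` and `ε y_0`, as a function of the
perturbations `y` in the cube. -/
noncomputable def pairSq (ε : ℝ) (f : E d → ℝ) (u : Window d r) : (Window d r → E d) → ℝ :=
  (cubeFamilies d r).indicator fun y => f (latticePoint u.1 + ε • (y u - y (windowZero d r))) ^ 2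

lemma pairSq_of_mem {y : Window d r → E d} (hy : y ∈ cubeFamilies d r) (ε : ℝ) (f : E d → ℝ)
    (u : Window d r) :
    pairSq ε f u y = f (latticePoint u.1 + ε • (y u - y (windowZero d r))) ^ 2 :=
  Set.indicator_of_mem hy _

lemma measurable_pairSq (hf : Continuous f) (ε : ℝ) (u : Window d r) :
    Measurable (pairSq ε f u) :=
  (by fun_prop : Continuous fun y : Window d r → E d =>
    f (latticePoint u.1 + ε • (y u - y (windowZero d r))) ^ 2).measurable.indicator
      measurableSet_cubeFamilies

lemma pairSq_nonneg (ε : ℝ) (f : E d → ℝ) (u : Window d r) (y : Window d r → E d) :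
    0 ≤ pairSq ε f u y :=
  Set.indicator_nonneg (fun _ _ => sq_nonneg _) y

lemma RegularKernel.abs_pairSq_le (hf : RegularKernel D f) (ε : ℝ) (u : Window d r)
    (y : Window d r → E d) : |pairSq ε f u y| ≤ D ^ 2 := by
  rw [abs_of_nonneg (pairSq_nonneg ε f u y)]
  refine Set.indicator_apply_le' (fun _ => ?_) fun _ => sq_nonneg D
  exact sq_le_sq.2 ((hf.abs_apply_le _).trans (le_abs_self D))

lemma measure_pi_pair_pos {ι α : Type*} [Fintype ι] [MeasurableSpace α]
    {μ : Measure α} [IsProbabilityMeasure μ] {i j : ι} (hij : i ≠ j) {U V : Set α} (hU : 0 < μ U)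
    (hV : 0 < μ V) : 0 < Measure.pi (fun _ : ι => μ) {y | y i ∈ U ∧ y j ∈ V} := by
  classical
  let s : ι → Set α := Function.update (Function.update (fun _ => Set.univ) j V) i U
  have hsub : Set.univ.pi s ⊆ {y | y i ∈ U ∧ y j ∈ V} := fun y hy =>
    ⟨by simpa [s] using hy i trivial, by simpa [s, hij.symm] using hy j trivial⟩
  refine lt_of_lt_of_le ?_ (measure_mono hsub)
  rw [Measure.pi_pi]
  refine CanonicallyOrderedAdd.prod_pos.2 fun w _ => ?_
  rcases eq_or_ne w i with rfl | hwi
  · simpa [s] using hU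
  · rcases eq_or_ne w j with rfl | hwj
    · simpa [s, hwi] using hV
    · simp [s, hwi, hwj]

lemma RegularKernel.integral_pairSq_pos {L : Measure (E d)} [IsProbabilityMeasure L]
    (hf : RegularKernel D f) (hL : L.support ⊆ {x | InCube x}) {u : Window d r} (hu : u.1 ≠ 0)
    {a b : E d} (ha : a ∈ L.support) (hb : b ∈ L.support)
    (hab : f (latticePoint u.1 + ε • (a - b)) ≠ 0) :
    0 < ∫ y, pairSq ε f u y ∂Measure.pi fun _ => L := by
  have hcont := hf.continuous
  rw [integral_pos_iff_support_of_nonneg (pairSq_nonneg ε f u)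
    (Integrable.of_bound (measurable_pairSq hcont ε u).aestronglyMeasurable (D ^ 2)
      (ae_of_all _ (hf.abs_pairSq_le ε u)))]
  have hnear : ∀ᶠ q : E d × E d in 𝓝 (a, b), f (latticePoint u.1 + ε • (q.1 - q.2)) ≠ 0 :=
    ContinuousAt.eventually_ne (by fun_prop) hab
  obtain ⟨U, V, hUo, haU, hVo, hbV, hUV⟩ := mem_nhds_prod_iff'.1 hnear
  have hpos : 0 < Measure.pi (fun _ : Window d r => L) {y | y u ∈ U ∧ y (windowZero d r) ∈ V} :=
    measure_pi_pair_pos (fun h => hu (congrArg Subtype.val h))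
      ((Measure.mem_support_iff_forall a).1 ha U (hUo.mem_nhds haU))
      ((Measure.mem_support_iff_forall b).1 hb V (hVo.mem_nhds hbV))
  rw [← measure_inter_conull (ae_iff.1 (ae_mem_cubeFamilies hL r))] at hpos
  refine hpos.trans_le (measure_mono ?_)
  rintro y ⟨⟨hyu, hy0⟩, hcube⟩
  rw [Function.mem_support, pairSq_of_mem hcube]
  exact pow_ne_zero 2 (hUV (Set.mk_mem_prod hyu hy0))

/-- The constant in the lower bound of the averages `gridAverage ε k f f`, when `c` and `A` are the
coercivity constant and a bound of the covariance matrices. -/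
noncomputable def formConst (c A : ℝ) : ℝ := 2 * c ^ 2 * (c / A ^ 2) / ((1 + A) * A) ^ 2

lemma formConst_pos {c A : ℝ} (hc : 0 < c) (hA : 0 < A) : 0 < formConst c A := by
  unfold formConst
  positivity

lemma localAverage_pairSq_le (f : E d → ℝ) (hv : v.Injective) {x : ℕ → E d}
    (hx : ∀ m, InCube (x m)) (u : Window d r) (n : ℕ) :
    localAverage v (pairSq ε f u) x n ≤ 1 / (n : ℝ) * ∑ i, ∑ j,
      kernelMatrix f (perturbedPoint ε (fun m : Fin n => site v m) fun m => x m) i j ^ 2 := by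
  classical
  rw [localAverage, Finset.sum_range, Finset.sum_comm]
  gcongr with l
  split_ifs with hl
  · have hentry : kernelMatrix f (perturbedPoint ε (fun m : Fin n => site v m) fun m => x m)
        (hl.embedding hv u) l = f (latticePoint u.1
          + ε • (patch v r x l u - patch v r x l (windowZero d r))) := by
      have hcentre := congrArg Fin.val (hl.embedding_windowZero hv)
      rw [kernelMatrix_perturbedPoint_apply, hl.site_embedding hv, add_sub_cancel_left]
      nth_rw 2 [← hcentre]
      rfl
    rw [pairSq_of_mem (y := patch v r x l) (fun _ => hx _), ← hentry]
    exact Finset.single_le_sum (f := fun i => kernelMatrix f _ i l ^ 2)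
      (fun _ _ => sq_nonneg _) (Finset.mem_univ _)
  · exact Finset.sum_nonneg fun _ _ => sq_nonneg _

lemma RegularCorrelation.formConst_mul_localAverage_le_gridAverage
    (hk : RegularCorrelation ε c C k) (hε : 0 ≤ ε) (hε' : ε < 1 / 2)
    (hf : ∀ t, f (-t) = f t) (hf0 : f 0 = 0) (hv : v.Injective) {x : ℕ → E d}
    (hx : ∀ m, InCube (x m)) (u : Window d r) (n : ℕ) :
    formConst c (opConst d ε C) * localAverage v (pairSq ε f u) x n
      ≤ gridAverage ε k f f v x n := by
  have hz := site_val_injective hv n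
  have hA := hk.opConst_pos hε'
  let t : Fin n → E d := perturbedPoint ε (fun m => site v m) fun m => x m
  have hle := sum_sq_le_sum_cvDiag hk.pos hA (transpose_kernelMatrix hk.regular.even t)
    (transpose_kernelMatrix hf t) (hk.regular.norm_kernelMatrix_le hε hε' hz fun m => hx m)
    (hk.coercive _ _ hz fun m => hx m)
    (fun i => (kernelMatrix_apply_self k t i).trans hk.apply_zero)
    (fun i => (kernelMatrix_apply_self f t i).trans hf0)
  refine (mul_le_mul_of_nonneg_left (localAverage_pairSq_le f hv hx u n)
    (formConst_pos hk.pos hA).le).trans ?_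
  rw [mul_left_comm]
  exact mul_le_mul_of_nonneg_left hle (by positivity)

variable {Ω : Type*} [MeasurableSpace Ω] {P : Measure Ω} [IsProbabilityMeasure P]
  {L : Measure (E d)} [IsProbabilityMeasure L] {X : ℕ → Ω → E d}

theorem RegularCorrelation.limit_gridAverage_pos (hk : RegularCorrelation ε c C k)
    (hf : RegularKernel D f) (hf0 : f 0 = 0) (hε : 0 ≤ ε) (hε' : ε < 1 / 2) (hd : 1 ≤ d)
    (hv : IsGridEnumeration v) (hL : L.support ⊆ {x | InCube x}) (hXm : ∀ i, Measurable (X i))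
    (hXind : iIndepFun X P) (hXlaw : ∀ i, P.map (X i) = L) {S : ℝ}
    (hS : ∀ᵐ ω ∂P, Tendsto (gridAverage ε k f f v (X · ω)) atTop (𝓝 S))
    (hne : ∃ t ∈ diffSet ε L.support, f t ≠ 0) : 0 < S := by
  obtain ⟨_, ⟨u, hu, a, ha, b, hb, rfl⟩, hab⟩ := hne
  obtain ⟨r, hr⟩ := exists_mem_window u
  have hpos := hf.integral_pairSq_pos hL (u := ⟨u, hr⟩) hu ha hb hab
  obtain ⟨ω, hlocal, hgrid, hcube⟩ := ((ae_tendsto_localAverage hd hv hXm hXind hXlaw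
    (measurable_pairSq hf.continuous ε ⟨u, hr⟩) (hf.abs_pairSq_le ε _)).and
    (hS.and (ae_forall_inCube hL hXm hXlaw))).exists
  exact (mul_pos (formConst_pos hk.pos (hk.opConst_pos hε')) hpos).trans_le
    (le_of_tendsto_of_tendsto' (hlocal.const_mul _) hgrid
      (hk.formConst_mul_localAverage_le_gridAverage hε hε' hf.even hf0 (hv.injective hd) hcube _))

end Positivity

section Model

variable {d p : ℕ} {θinf θsup ε : ℝ} {K : (Fin p → ℝ) → E d → ℝ} {θ : Fin p → ℝ}
  {v : ℕ → Fin d → ℕ} {L : Measure (E d)}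

lemma latticePoint_zero : (latticePoint 0 : E d) = 0 := by
  ext
  simp [latticePoint]

lemma derivComb_apply_zero (hθ : θ ∈ paramBox p θinf θsup)
    (hcorr : ∀ ϑ ∈ paramBox p θinf θsup, K ϑ 0 = 1) (lam : Fin p → ℝ) :
    derivComb θinf θsup K θ lam 0 = 0 :=
  Finset.sum_eq_zero fun i _ => by rw [partialDeriv_apply_zero hθ hcorr, mul_zero]

lemma exists_mem_diffSet_derivComb_ne_zero (hθ : θ ∈ paramBox p θinf θsup)
    (hcorr : ∀ ϑ ∈ paramBox p θinf θsup, K ϑ 0 = 1) (hL : L.support.Nonempty) {lam : Fin p → ℝ}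
    {u : Fin d → ℤ} (hu : derivComb θinf θsup K θ lam (latticePoint u) ≠ 0) (ε : ℝ) :
    ∃ t ∈ diffSet ε L.support, derivComb θinf θsup K θ lam t ≠ 0 := by
  obtain ⟨a, ha⟩ := hL
  refine ⟨_, ⟨u, ?_, a, ha, a, ha, by simp⟩, hu⟩
  rintro rfl
  exact hu (latticePoint_zero (d := d) ▸ derivComb_apply_zero hθ hcorr lam)

lemma ModelCondition.continuous_derivComb (hK : ModelCondition d p θinf θsup K)
    (hθ : ∀ i, θinf < θ i ∧ θ i < θsup) (lam : Fin p → ℝ) :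
    Continuous (derivComb θinf θsup K θ lam) :=
  let ⟨_, hg⟩ := hK.exists_regularKernel_partialDeriv hθ
  (RegularKernel.sum_mul hg lam).continuous

lemma exists_mem_ne_zero_of_not_ae_restrict {α : Type*} [TopologicalSpace α] [MeasurableSpace α]
    [OpensMeasurableSpace α] {μ : Measure α} {f : α → ℝ} (hf : Continuous f) {s : Set α}
    (h : ¬ ∀ᵐ t ∂μ.restrict s, f t = 0) : ∃ t ∈ s, f t ≠ 0 := by
  contrapose! h
  rw [ae_restrict_iff (isClosed_eq hf continuous_const).measurableSet]
  exact ae_of_all _ h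

lemma RegularCorrelation.one_div_mul_trace_cvHessian {c C : ℝ}
    (hk : RegularCorrelation ε c C (K θ)) (hε : 0 ≤ ε) (hε' : ε < 1 / 2) (hv : v.Injective)
    {x : ℕ → E d} (hx : ∀ m, InCube (x m)) (n : ℕ) (i j : Fin p) :
    1 / (n : ℝ) * (cvHessian θinf θsup K v ε x n θ i j).trace
      = gridAverage ε (K θ) (fun t => partialDeriv θinf θsup i (fun ϑ => K ϑ t) θ)
        (fun t => partialDeriv θinf θsup j (fun ϑ => K ϑ t) θ) v x n := by
  have hz := site_val_injective hv n
  have hC := hk.opConst_pos hε'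
  have hne : ∀ l, (covMatrix K v ε x n θ)⁻¹ l l ≠ 0 := fun l =>
    ((div_pos hk.pos (pow_pos hC 2)).trans_le ((hk.coercive _ _ hz fun m => hx m).le_inv_apply_self
      hk.pos hC (hk.regular.norm_kernelMatrix_le hε hε' hz fun m => hx m) l)).ne'
  rw [cvHessian, trace_cvHessianOf hne]
  rfl

lemma posDef_of_sum_mul_pos {ι : Type*} [Fintype ι] {S : ι → ι → ℝ} (hS : ∀ i j, S i j = S j i)
    (hpos : ∀ lam : ι → ℝ, lam ≠ 0 → 0 < ∑ i, ∑ j, lam i * lam j * S i j) :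
    (Matrix.of S).PosDef := by
  refine Matrix.PosDef.of_dotProduct_mulVec_pos (Matrix.IsHermitian.ext fun i j => hS j i)
    fun lam hlam => (hpos lam hlam).trans_eq ?_
  simp only [dotProduct, Matrix.mulVec, Finset.mul_sum, Matrix.of_apply, star_trivial]
  exact Finset.sum_congr rfl fun i _ => Finset.sum_congr rfl fun j _ => by ring

end Model

end CrossValidation

open CrossValidation in
theorem mainTheorem7_general (d p : ℕ) (hd : 1 ≤ d) (θinf θsup : ℝ) (θ0 : Fin p → ℝ)
    (hθ0 : ∀ i, θinf < θ0 i ∧ θ0 i < θsup) (K : (Fin p → ℝ) → E d → ℝ)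
    (hK : ModelCondition d p θinf θsup K) (hcorr : ∀ θ ∈ paramBox p θinf θsup, K θ 0 = 1)
    (v : ℕ → Fin d → ℕ) (hv : IsGridEnumeration v) (ε : ℝ) (hε : 0 ≤ ε) (hε' : ε < 1 / 2)
    (L : Measure (E d)) (hL : L.support ⊆ {x | ∀ k, |x k| ≤ 1})
    {Ω : Type*} [MeasurableSpace Ω] (P : Measure Ω) [IsProbabilityMeasure P]
    (X : ℕ → Ω → E d) (hXm : ∀ i, Measurable (X i)) (hXind : iIndepFun X P)
    (hXlaw : ∀ i, P.map (X i) = L) :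
    ∃ S : Matrix (Fin p) (Fin p) ℝ, IsSigmaCV2 P θinf θsup K v ε X θ0 S ∧
      ((∀ lam : Fin p → ℝ, lam ≠ 0 →
        ∃ t ∈ diffSet ε L.support, derivComb θinf θsup K θ0 lam t ≠ 0) → S.PosDef) := by
  have : IsProbabilityMeasure L := hXlaw 0 ▸ Measure.isProbabilityMeasure_map (hXm 0).aemeasurable
  have hmem : θ0 ∈ paramBox p θinf θsup := fun i => ⟨(hθ0 i).1.le, (hθ0 i).2.le⟩
  obtain ⟨c, C, hk⟩ := hK.exists_regularCorrelation hmem hcorr hε hε'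
  obtain ⟨C', hg⟩ := hK.exists_regularKernel_partialDeriv hθ0
  replace hk := hk.mono (le_max_left C C')
  replace hg := fun i => (hg i).mono (le_max_right C C')
  choose S hS using fun i j =>
    hk.exists_ae_tendsto_gridAverage (hg i) (hg j) hε hε' hd hv hL hXm hXind hXlaw
  have hsymm : ∀ i j, S i j = S j i := fun i j => by
    obtain ⟨ω, hij, hji⟩ := ((hS i j).and (hS j i)).exists
    refine tendsto_nhds_unique hij (hji.congr fun n => ?_)
    exact gridAverage_comm hk.regular.even (hg j).even (hg i).even _ _ _ _
  refine ⟨Matrix.of S, fun i j => ?_, fun hne => posDef_of_sum_mul_pos hsymm fun lam hlam => ?_⟩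
  · filter_upwards [hS i j, ae_forall_inCube hL hXm hXlaw] with ω hω hcube
    exact hω.congr fun n =>
      (hk.one_div_mul_trace_cvHessian hε hε' (hv.injective hd) hcube n i j).symm
  · refine hk.limit_gridAverage_pos (RegularKernel.sum_mul hg lam)
      (derivComb_apply_zero hmem hcorr lam) hε hε' hd hv hL hXm hXind hXlaw ?_ (hne lam hlam)
    filter_upwards [ae_all_iff.2 fun i => ae_all_iff.2 (hS i)] with ω hω
    exact (tendsto_finsetSum _ fun i _ => tendsto_finsetSum _ fun j _ =>
      (hω i j).const_mul (lam i * lam j)).congr fun n =>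
        (gridAverage_sum_mul ε (K θ0) _ lam v _ n).symm

open CrossValidation in
theorem mainTheorem7 (d p : ℕ) (hd : 1 ≤ d)
    (θinf θsup : ℝ) (θ0 : Fin p → ℝ) (hθ0 : ∀ i, θinf < θ0 i ∧ θ0 i < θsup)
    (K : (Fin p → ℝ) → CrossValidation.E d → ℝ)
    (hK : CrossValidation.ModelCondition d p θinf θsup K)
    (hcorr : ∀ θ ∈ CrossValidation.paramBox p θinf θsup, K θ 0 = 1)
    (v : ℕ → Fin d → ℕ) (hv : CrossValidation.IsGridEnumeration v)
    (ε : ℝ) (hε : 0 ≤ ε) (hε' : ε < 1 / 2)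
    (L : Measure (CrossValidation.E d)) (hL : CrossValidation.PerturbationLaw L)
    {Ω : Type*} [MeasurableSpace Ω] (P : Measure Ω) [IsProbabilityMeasure P]
    (X : ℕ → Ω → CrossValidation.E d) (hXm : ∀ i, Measurable (X i))
    (hXind : iIndepFun X P) (hXlaw : ∀ i, P.map (X i) = L) :
    ∃ S : Matrix (Fin p) (Fin p) ℝ,
      CrossValidation.IsSigmaCV2 P θinf θsup K v ε X θ0 S ∧
      (ε = 0 →
        (¬ ∃ lam : Fin p → ℝ, lam ≠ 0 ∧ ∀ u : Fin d → ℤ,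
          CrossValidation.derivComb θinf θsup K θ0 lam (CrossValidation.latticePoint u) = 0) →
        S.PosDef) ∧
      (ε ≠ 0 →
        (¬ ∃ lam : Fin p → ℝ, lam ≠ 0 ∧
          ∀ᵐ t ∂(volume.restrict (CrossValidation.diffSet ε L.support)),
            CrossValidation.derivComb θinf θsup K θ0 lam t = 0) →
        S.PosDef) := by
  have := hL.isProbability
  obtain ⟨S, hS, hpos⟩ := mainTheorem7_general d p hd θinf θsup θ0 hθ0 K hK hcorr v hv ε hε hε' L
    hL.support_subset P X hXm hXind hXlaw
  refine ⟨S, hS, fun _ hind => hpos fun lam hlam => ?_, fun _ hind => hpos fun lam hlam => ?_⟩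
  · obtain ⟨u, hu⟩ := not_forall.1 fun h => hind ⟨lam, hlam, h⟩
    exact exists_mem_diffSet_derivComb_ne_zero (fun i => ⟨(hθ0 i).1.le, (hθ0 i).2.le⟩) hcorr
      (Measure.nonempty_support (IsProbabilityMeasure.ne_zero L)) hu ε
  · exact exists_mem_ne_zero_of_not_ae_restrict (hK.continuous_derivComb hθ0 lam)
      fun h => hind ⟨lam, hlam, h⟩
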